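/- Let $\mathcal G$ be a locally compact, not necessarily Hausdorff, étale groupoid: a groupoid with a locally compact topology such that the groupoid operations are continuous, the unit space $\mathcal G^{(0)}\subset\mathcal G$ is locally compact Hausdorff in the relative topology, and the range and source maps $r,s\colon\mathcal G\to\mathcal G^{(0)}$ are local homeomorphisms. Write $\mathcal G_x=s^{-1}(x)$, $\mathcal G^x=r^{-1}(x)$ and $\mathcal G_x^x=\mathcal G_x\cap\mathcal G^x$ for $x\in\mathcal G^{(0)}$. Let $C_c(\mathcal G)$ be the linear span, in the space of all complex functions on $\mathcal G$, of the extensions by zero of the continuous compactly supported functions on open Hausdorff subsets of $\mathcal G$; it is a $*$-algebra with the convolution product $(f_1*f_2)(g)=\sum_{h\in\mathcal G^{r(g)}}f_1(h)f_2(h^{-1}g)$ and the involution $f^*(g)=\overline{f(g^{-1})}$. For $x\in\mathcal G^{(0)}$ let $\rho_x$ be the representation of $C_c(\mathcal G)$ on $\ell^2(\mathcal G_x)$ given by $$(\rho_x(f)\xi)(g)=\sum_{h\in\mathcal G^{r(g)}}f(h)\,\xi(h^{-1}g),$$ and let $C^*_r(\mathcal G)$ be the completion of $C_c(\mathcal G)$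 with respect to the norm $\|f\|_r=\sup_{x\in\mathcal G^{(0)}}\|\rho_x(f)\|$; we use the same symbol $\rho_x$ for the extension to $C^*_r(\mathcal G)$. A representation $\pi$ of a C$^*$-algebra is weakly contained in a representation $\sigma$ if $\ker\sigma\subset\ker\pi$. An open bisection is an open subset of $\mathcal G$ on which $r$ and $s$ are injective. Let $Y\subset\mathcal G^{(0)}$ be a $\mathcal G$-invariant subset and let $x\in(\mathcal G^{(0)}\cap\bar Y)\setminus Y$. Assume that for every finite set of distinct nontrivial cyclic subgroups $G_1,\dots,G_n$ of $\mathcal G_x^x$ we have $$\sum_{k=1}^n\frac1{|G_k|}<1\qquad(\text{with } 1/|G_k|=0 \text{ if } G_k \text{ is infinite}).$$ Then $\rho_x$ is weakly contained in $\bigoplus_{y\in Y}\rho_y$ if and only if the following condition is **not** satisfied: (*) for some $n\ge1$, there are elements $g_1,\dots,g_n\in\mathcal G_x^x\setminus\{x\}$, open bisections $U_1,\dots,U_n$ with $g_k\in U_k$ for all $k$, and a neighbourhood $U$ of $x$ in $\mathcal G^{(0)}$ such that $Y\cap U\subset U_1\cup\dots\cup U_n$. Moreover, (*) is not satisfied if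 and only if there is a net in $Y$ such that $x$ is its unique accumulation point in $\mathcal G_x^x$. -/

import Mathlib

universe u v

noncomputable section

namespace EtaleGroupoid


open Filter Topology
open scoped ENNReal

/-- A groupoid, given by its set `G` of arrows, with units identified with identity arrows.  The
product `g * h` is meaningful exactly when `source g = range h`; the laws constrain it only for
such pairs, and its values on other pairs are irrelevant in everything below. -/
class ArrowGroupoid (G : Type u) extends Mul G, Inv G where
  source : G → G
  range : G → G
  source_source (g : G) : source (source g) = source g
  range_source (g : G) : range (source g) = source g
  source_range (g : G) : source (range g) = range g
  range_range (g : G) : range (range g) = range g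
  source_mul (g h : G) (hgh : source g = range h) : source (g * h) = source h
  range_mul (g h : G) (hgh : source g = range h) : range (g * h) = range g
  assoc (g h k : G) (hgh : source g = range h) (hhk : source h = range k) :
    (g * h) * k = g * (h * k)
  mul_source (g : G) : g * source g = g
  range_mul_self (g : G) : range g * g = g
  source_inv (g : G) : source g⁻¹ = range g
  range_inv (g : G) : range g⁻¹ = source g
  inv_mul_self (g : G) : g⁻¹ * g = source g
  mul_inv_self (g : G) : g * g⁻¹ = range g

open ArrowGroupoid

/-- The unit space `G⁽⁰⁾ ⊆ G`. -/
def UnitSpace (G : Type u) [ArrowGroupoid G] : Type u := {x : G // source x = x}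

section Algebraic
variable {G : Type u} [ArrowGroupoid G]

instance : CoeOut (UnitSpace G) G := ⟨Subtype.val⟩
instance [TopologicalSpace G] : TopologicalSpace (UnitSpace G) := instTopologicalSpaceSubtype

/-- The source map `s : G → G⁽⁰⁾`. -/
def src (g : G) : UnitSpace G := ⟨source g, source_source g⟩
/-- The range map `r : G → G⁽⁰⁾`. -/
def rng (g : G) : UnitSpace G := ⟨range g, source_range g⟩

theorem UnitSpace.range_eq (x : UnitSpace G) : range (x : G) = x := by
  have h := range_source (x : G)
  rwa [x.2] at h

theorem src_mul {g h : G} (hgh : src g = rng h) : src (g * h) = src h :=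
  Subtype.ext (source_mul g h (congrArg Subtype.val hgh))
theorem rng_mul {g h : G} (hgh : src g = rng h) : rng (g * h) = rng g :=
  Subtype.ext (range_mul g h (congrArg Subtype.val hgh))
theorem src_inv (g : G) : src g⁻¹ = rng g := Subtype.ext (source_inv g)
theorem rng_inv (g : G) : rng g⁻¹ = src g := Subtype.ext (range_inv g)
theorem src_coe (x : UnitSpace G) : src (x : G) = x := Subtype.ext x.2
theorem rng_coe (x : UnitSpace G) : rng (x : G) = x := Subtype.ext x.range_eq

theorem range_of_rng {g : G} {x : UnitSpace G} (h : rng g = x) : range g = x :=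
  congrArg Subtype.val h
theorem source_of_src {g : G} {x : UnitSpace G} (h : src g = x) : source g = x :=
  congrArg Subtype.val h

theorem mul_assoc_of {g h k : G} (h₁ : src g = rng h) (h₂ : src h = rng k) :
    (g * h) * k = g * (h * k) :=
  assoc g h k (congrArg Subtype.val h₁) (congrArg Subtype.val h₂)

/-- The isotropy group `G_x^x = G_x ∩ G^x`. -/
def Isotropy (x : UnitSpace G) : Type u := {g : G // src g = x ∧ rng g = x}
instance (x : UnitSpace G) : CoeOut (Isotropy x) G := ⟨Subtype.val⟩

instance (x : UnitSpace G) : Group (Isotropy x) where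
  mul g h := ⟨g.1 * h.1, by
    have e : src g.1 = rng h.1 := g.2.1.trans h.2.2.symm
    exact ⟨(src_mul e).trans h.2.1, (rng_mul e).trans g.2.2⟩⟩
  one := ⟨x, src_coe x, rng_coe x⟩
  inv g := ⟨g.1⁻¹, (src_inv g.1).trans g.2.2, (rng_inv g.1).trans g.2.1⟩
  mul_assoc g h k := Subtype.ext
    (mul_assoc_of (g.2.1.trans h.2.2.symm) (h.2.1.trans k.2.2.symm))
  one_mul g := Subtype.ext (by
    have h := range_mul_self g.1
    rwa [show range g.1 = x.1 from congrArg Subtype.val g.2.2] at h)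
  mul_one g := Subtype.ext (by
    have h := mul_source g.1
    rwa [show source g.1 = x.1 from congrArg Subtype.val g.2.1] at h)
  inv_mul_cancel g := Subtype.ext
    ((inv_mul_self g.1).trans (congrArg Subtype.val g.2.1))

/-- `G_x = s⁻¹(x)`. -/
def SourceFiber (x : UnitSpace G) : Type u := {g : G // src g = x}
/-- `G^x = r⁻¹(x)`. -/
def RangeFiber (x : UnitSpace G) : Type u := {g : G // rng g = x}



theorem src_div {x : UnitSpace G} (g k : SourceFiber x) : src g.1 = rng (k.1)⁻¹ := by
  rw [rng_inv, g.2, k.2]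

theorem src_inv_mul {x : UnitSpace G} (g : SourceFiber x) (h : RangeFiber (rng g.1)) :
    src (h.1⁻¹ * g.1) = x := by
  rw [src_mul (by rw [src_inv, h.2]), g.2]

/-- For `g ∈ G_x`, the bijection `h ↦ h⁻¹ g` from `G^{r(g)}` onto `G_x`. -/
def fiberEquiv {x : UnitSpace G} (g : SourceFiber x) : RangeFiber (rng g.1) ≃ SourceFiber x where
  toFun h := ⟨h.1⁻¹ * g.1, src_inv_mul g h⟩
  invFun k := ⟨g.1 * k.1⁻¹, rng_mul (src_div g k)⟩
  left_inv h := by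
    apply Subtype.ext
    have h1 : src h.1⁻¹ = rng g.1 := by rw [src_inv, h.2]
    have h2 : h.1 * (h.1⁻¹ * g.1) = g.1 := by
      rw [← mul_assoc_of (rng_inv h.1).symm h1, mul_inv_self, range_of_rng h.2]
      exact range_mul_self g.1
    have h3 : rng (h.1⁻¹ * g.1) = src h.1 := by rw [rng_mul h1, rng_inv]
    change g.1 * (h.1⁻¹ * g.1)⁻¹ = h.1
    conv_lhs => enter [1]; rw [← h2]
    rw [mul_assoc_of h3.symm (rng_inv _).symm, mul_inv_self, range_of_rng h3]
    exact mul_source h.1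
  right_inv k := by
    apply Subtype.ext
    have h1 : src g.1 = rng k.1⁻¹ := src_div g k
    have h2 : (g.1 * k.1⁻¹) * k.1 = g.1 := by
      rw [mul_assoc_of h1 (src_inv k.1), inv_mul_self, source_of_src k.2, ← source_of_src g.2]
      exact mul_source g.1
    have h3 : src (g.1 * k.1⁻¹) = rng k.1 := by rw [src_mul h1, src_inv]
    change (g.1 * k.1⁻¹)⁻¹ * g.1 = k.1
    conv_lhs => enter [2]; rw [← h2]
    rw [← mul_assoc_of (src_inv _) h3, inv_mul_self, source_of_src h3]
    exact range_mul_self k.1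

/-- The Hilbert space `ℓ²(G_x)`. -/
abbrev HilbertFiber (x : UnitSpace G) : Type u := lp (fun _ : SourceFiber x => ℂ) 2

/-- The formula `(ρ_x(f)ξ)(g) = ∑_{h ∈ G^{r(g)}} f(h) ξ(h⁻¹g)`. -/
def rhoFun (x : UnitSpace G) (f : G → ℂ) (ξ : SourceFiber x → ℂ) (g : SourceFiber x) : ℂ :=
  ∑' h : RangeFiber (rng g.1), f h.1 * ξ ⟨h.1⁻¹ * g.1, src_inv_mul g h⟩

theorem rhoFun_eq (x : UnitSpace G) (f : G → ℂ) (ξ : SourceFiber x → ℂ) (g : SourceFiber x) :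
    rhoFun x f ξ g = ∑' k : SourceFiber x, f (g.1 * k.1⁻¹) * ξ k := by
  rw [rhoFun, ← (fiberEquiv g).symm.tsum_eq]
  refine tsum_congr fun k => ?_
  congr 2
  exact (fiberEquiv g).apply_symm_apply k

end Algebraic

section Schur
variable {ι : Type u}

theorem schur_bound (k : ι → ι → ℂ) (N : ℕ) (M : ℝ) (hM : ∀ i j, ‖k i j‖ ≤ M)
    (hrow : ∀ i, {j | k i j ≠ 0}.encard ≤ N) (hcol : ∀ j, {i | k i j ≠ 0}.encard ≤ N)
    (ξ : lp (fun _ : ι => ℂ) 2) (T : Finset ι) :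
    ∑ i ∈ T, ‖∑' j, k i j * ξ j‖ ^ 2 ≤ (N * M * ‖ξ‖) ^ 2 := by
  classical
  have hfin : ∀ i, {j | k i j ≠ 0}.Finite := fun i =>
    Set.finite_of_encard_le_coe (hrow i)
  let S : ι → Finset ι := fun i => (hfin i).toFinset
  have hS : ∀ i, (S i).card ≤ N := fun i => by
    have := hrow i
    rw [(hfin i).encard_eq_coe_toFinset_card] at this
    exact_mod_cast this
  have hmem : ∀ i j, j ∈ S i ↔ k i j ≠ 0 := fun i j => by simp [S]
  have hsum : ∀ i, ∑' j, k i j * ξ j = ∑ j ∈ S i, k i j * ξ j := fun i =>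
    tsum_eq_sum fun j hj => by
      rw [hmem, not_not] at hj
      rw [hj, zero_mul]
  have h1 : ∀ i, ‖∑' j, k i j * ξ j‖ ^ 2 ≤ N * M ^ 2 * ∑ j ∈ S i, ‖ξ j‖ ^ 2 := fun i => by
    rw [hsum]
    calc ‖∑ j ∈ S i, k i j * ξ j‖ ^ 2 ≤ (∑ j ∈ S i, M * ‖ξ j‖) ^ 2 := by
          gcongr
          refine (norm_sum_le _ _).trans (Finset.sum_le_sum fun j _ => ?_)
          rw [norm_mul]
          gcongr
          exact hM i j
      _ ≤ (S i).card * ∑ j ∈ S i, (M * ‖ξ j‖) ^ 2 := sq_sum_le_card_mul_sum_sq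
      _ ≤ N * ∑ j ∈ S i, (M * ‖ξ j‖) ^ 2 := by
          gcongr
          exact hS i
      _ = N * M ^ 2 * ∑ j ∈ S i, ‖ξ j‖ ^ 2 := by
          simp_rw [mul_pow, ← Finset.mul_sum, mul_assoc]
  let J : Finset ι := T.biUnion S
  have h2 : ∑ i ∈ T, ∑ j ∈ S i, ‖ξ j‖ ^ 2 ≤ N * ∑ j ∈ J, ‖ξ j‖ ^ 2 := by
    have : ∀ i ∈ T, ∑ j ∈ S i, ‖ξ j‖ ^ 2 = ∑ j ∈ J, if k i j ≠ 0 then ‖ξ j‖ ^ 2 else 0 := by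
      intro i hi
      rw [← Finset.sum_filter]
      refine Finset.sum_congr ?_ fun _ _ => rfl
      ext j
      simp only [Finset.mem_filter, J, Finset.mem_biUnion, hmem]
      exact ⟨fun h => ⟨⟨i, hi, h⟩, h⟩, fun h => h.2⟩
    rw [Finset.sum_congr rfl this, Finset.sum_comm, Finset.mul_sum]
    refine Finset.sum_le_sum fun j _ => ?_
    rw [← Finset.sum_filter, Finset.sum_const, nsmul_eq_mul]
    gcongr
    have h3 : ((T.filter fun i => k i j ≠ 0 : Finset ι) : Set ι).encard ≤ N :=
      (Set.encard_le_encard (fun i hi => by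
        have := Finset.mem_coe.1 hi
        exact (Finset.mem_filter.1 this).2)).trans (hcol j)
    rw [Set.encard_coe_eq_coe_finsetCard] at h3
    exact_mod_cast h3
  have h4 : ∑ j ∈ J, ‖ξ j‖ ^ 2 ≤ ‖ξ‖ ^ 2 := by
    have := lp.sum_rpow_le_norm_rpow (p := 2) (by norm_num) ξ J
    simpa using this
  calc ∑ i ∈ T, ‖∑' j, k i j * ξ j‖ ^ 2 ≤ ∑ i ∈ T, N * M ^ 2 * ∑ j ∈ S i, ‖ξ j‖ ^ 2 :=
        Finset.sum_le_sum fun i _ => h1 i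
    _ = N * M ^ 2 * ∑ i ∈ T, ∑ j ∈ S i, ‖ξ j‖ ^ 2 := by rw [Finset.mul_sum]
    _ ≤ N * M ^ 2 * (N * ‖ξ‖ ^ 2) := by
        gcongr
        exact h2.trans (by gcongr)
    _ = (N * M * ‖ξ‖) ^ 2 := by ring

end Schur

section Etale
variable (G : Type u) [TopologicalSpace G] [ArrowGroupoid G]

/-- A locally compact, not necessarily Hausdorff, étale groupoid. -/
class IsLocallyCompactEtale : Prop where
  locallyCompactSpace : LocallyCompactSpace G
  continuous_inv : Continuous fun g : G => g⁻¹
  continuousOn_mul : ContinuousOn (fun p : G × G => p.1 * p.2) {p | src p.1 = rng p.2}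
  unitSpace_t2 : T2Space (UnitSpace G)
  unitSpace_locallyCompact : LocallyCompactSpace (UnitSpace G)
  isLocalHomeomorph_src : IsLocalHomeomorph (src : G → UnitSpace G)
  isLocalHomeomorph_rng : IsLocalHomeomorph (rng : G → UnitSpace G)

/-- `C_c(G)`: the linear span, inside the space of all functions `G → ℂ`, of the extensions by zero
of the continuous compactly supported functions on open Hausdorff subsets `V` of `G`. -/
def Cc : Submodule ℂ (G → ℂ) :=
  Submodule.span ℂ {f | ∃ V : Set G, IsOpen V ∧ T2Space V ∧
    Continuous (V.domRestrict f) ∧ HasCompactSupport (V.domRestrict f) ∧ ∀ g ∉ V, f g = 0}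

variable {G}

/-- `f` is bounded by `M` and has at most `N` nonzero values on every source and range fibre. -/
structure FiberBound (f : G → ℂ) (N : ℕ) (M : ℝ) : Prop where
  norm_le (g : G) : ‖f g‖ ≤ M
  src_le (x : UnitSpace G) : {g | src g = x ∧ f g ≠ 0}.encard ≤ N
  rng_le (x : UnitSpace G) : {g | rng g = x ∧ f g ≠ 0}.encard ≤ N

theorem FiberBound.nonneg {f : G → ℂ} {N : ℕ} {M : ℝ} (h : FiberBound f N M) (x : UnitSpace G) :
    0 ≤ M := (norm_nonneg _).trans (h.norm_le x)

theorem FiberBound.add {f₁ f₂ : G → ℂ} {N₁ N₂ : ℕ} {M₁ M₂ : ℝ} (h₁ : FiberBound f₁ N₁ M₁)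
    (h₂ : FiberBound f₂ N₂ M₂) : FiberBound (f₁ + f₂) (N₁ + N₂) (M₁ + M₂) := by
  have key : ∀ P : G → Prop, {g | P g ∧ (f₁ + f₂) g ≠ 0} ⊆
      {g | P g ∧ f₁ g ≠ 0} ∪ {g | P g ∧ f₂ g ≠ 0} := by
    rintro P g ⟨hg, hne⟩
    by_cases h : f₁ g = 0
    · exact Or.inr ⟨hg, fun h' => hne (by simp [h, h'])⟩
    · exact Or.inl ⟨hg, h⟩
  refine ⟨fun g => (norm_add_le _ _).trans (add_le_add (h₁.norm_le g) (h₂.norm_le g)),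
    fun x => ?_, fun x => ?_⟩
  · refine ((Set.encard_le_encard (key _)).trans (Set.encard_union_le _ _)).trans ?_
    push_cast
    exact add_le_add (h₁.src_le x) (h₂.src_le x)
  · refine ((Set.encard_le_encard (key _)).trans (Set.encard_union_le _ _)).trans ?_
    push_cast
    exact add_le_add (h₁.rng_le x) (h₂.rng_le x)

theorem FiberBound.smul {f : G → ℂ} {N : ℕ} {M : ℝ} (h : FiberBound f N M) (c : ℂ) :
    FiberBound (c • f) N (‖c‖ * M) := by
  refine ⟨fun g => ?_, fun x => ?_, fun x => ?_⟩
  · simp only [Pi.smul_apply, norm_smul]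
    gcongr
    exact h.norm_le g
  · refine (Set.encard_le_encard fun g hg => ?_).trans (h.src_le x)
    exact ⟨hg.1, fun h0 => hg.2 (by simp [h0])⟩
  · refine (Set.encard_le_encard fun g hg => ?_).trans (h.rng_le x)
    exact ⟨hg.1, fun h0 => hg.2 (by simp [h0])⟩

theorem encard_le_of_cover (p : G → UnitSpace G) (W : G → Set G) (t : Finset G)
    (hinj : ∀ g, Set.InjOn p (W g)) (A : Set G) (hA : A ⊆ ⋃ g ∈ t, W g) (x : UnitSpace G)
    (hx : ∀ g ∈ A, p g = x) : A.encard ≤ t.card := by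
  choose! c hc using fun g (hg : g ∈ A) => Set.mem_iUnion₂.1 (hA hg)
  have hinjc : Set.InjOn c A := fun g hg h hh e => by
    obtain ⟨-, h1⟩ := hc g hg
    obtain ⟨-, h2⟩ := hc h hh
    rw [← e] at h2
    exact hinj _ h1 h2 ((hx g hg).trans (hx h hh).symm)
  rw [← hinjc.encard_image, ← Set.encard_coe_eq_coe_finsetCard]
  refine Set.encard_le_encard ?_
  rintro _ ⟨g, hg, rfl⟩
  exact (hc g hg).1

theorem exists_fiberBound [IsLocallyCompactEtale G] (f : Cc G) :
    ∃ (N : ℕ) (M : ℝ), FiberBound (f : G → ℂ) N M := by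
  obtain ⟨f, hf⟩ := f
  change ∃ (N : ℕ) (M : ℝ), FiberBound f N M
  induction hf using Submodule.span_induction with
  | zero => exact ⟨0, 0, by simp, by simp, by simp⟩
  | add f₁ f₂ _ _ h₁ h₂ =>
    obtain ⟨N₁, M₁, h₁⟩ := h₁
    obtain ⟨N₂, M₂, h₂⟩ := h₂
    exact ⟨_, _, h₁.add h₂⟩
  | smul c f _ h =>
    obtain ⟨N, M, h⟩ := h
    exact ⟨_, _, h.smul c⟩
  | mem f hf =>
    obtain ⟨V, -, -, hcont, hsupp, hzero⟩ := hf
    obtain ⟨C, hC⟩ := hsupp.exists_bound_of_continuous hcont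
    have hK : IsCompact (Subtype.val '' tsupport (V.domRestrict f)) :=
      IsCompact.image hsupp continuous_subtype_val
    have hsub : ∀ g, f g ≠ 0 → g ∈ Subtype.val '' tsupport (V.domRestrict f) := fun g hg => by
      have hgV : g ∈ V := by
        by_contra h
        exact hg (hzero g h)
      exact ⟨⟨g, hgV⟩, subset_tsupport _ hg, rfl⟩
    have hW : ∀ g : G, ∃ W ∈ 𝓝 g, Set.InjOn (src : G → UnitSpace G) W ∧
        Set.InjOn (rng : G → UnitSpace G) W := fun g => by
      obtain ⟨e, he, h1⟩ := IsLocallyCompactEtale.isLocalHomeomorph_src (G := G) g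
      obtain ⟨e', he', h2⟩ := IsLocallyCompactEtale.isLocalHomeomorph_rng (G := G) g
      refine ⟨e.source ∩ e'.source, inter_mem (e.open_source.mem_nhds he)
        (e'.open_source.mem_nhds he'), ?_, ?_⟩
      · rw [h1]
        exact e.injOn.mono Set.inter_subset_left
      · rw [h2]
        exact e'.injOn.mono Set.inter_subset_right
    choose W hWn hWs hWr using hW
    obtain ⟨t, -, ht⟩ := hK.elim_nhds_subcover W fun g _ => hWn g
    refine ⟨t.card, max C 0, fun g => ?_, fun x => ?_, fun x => ?_⟩
    · by_cases hg : g ∈ V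
      · exact (hC ⟨g, hg⟩).trans (le_max_left _ _)
      · simp [hzero g hg]
    · exact encard_le_of_cover src W t hWs _ (fun g hg => ht (hsub g hg.2)) x fun g hg => hg.1
    · exact encard_le_of_cover rng W t hWr _ (fun g hg => ht (hsub g hg.2)) x fun g hg => hg.1

theorem rhoFun_row {f : G → ℂ} {N : ℕ} {M : ℝ} (h : FiberBound f N M) {x : UnitSpace G}
    (g : SourceFiber x) : {k : SourceFiber x | f (g.1 * k.1⁻¹) ≠ 0}.encard ≤ N := by
  have hinj : Function.Injective fun k : SourceFiber x => g.1 * k.1⁻¹ := fun k l e =>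
    (fiberEquiv g).symm.injective (Subtype.ext e)
  rw [← hinj.encard_image]
  refine (Set.encard_le_encard ?_).trans (h.rng_le (rng g.1))
  rintro _ ⟨k, hk, rfl⟩
  exact ⟨rng_mul (src_div g k), hk⟩

theorem rhoFun_col {f : G → ℂ} {N : ℕ} {M : ℝ} (h : FiberBound f N M) {x : UnitSpace G}
    (k : SourceFiber x) : {g : SourceFiber x | f (g.1 * k.1⁻¹) ≠ 0}.encard ≤ N := by
  have hinj : Function.Injective fun g : SourceFiber x => g.1 * k.1⁻¹ := fun g l e => by
    have hc : ∀ g : SourceFiber x, (g.1 * k.1⁻¹) * k.1 = g.1 := fun g => by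
      rw [mul_assoc_of (src_div g k) (src_inv k.1), inv_mul_self, source_of_src k.2,
        ← source_of_src g.2]
      exact mul_source g.1
    apply Subtype.ext
    rw [← hc g, ← hc l]
    exact congrArg (· * k.1) e
  rw [← hinj.encard_image]
  refine (Set.encard_le_encard ?_).trans (h.src_le (rng k.1))
  rintro _ ⟨g, hg, rfl⟩
  exact ⟨(src_mul (src_div g k)).trans (src_inv k.1), hg⟩

theorem rhoFun_bound {f : G → ℂ} {N : ℕ} {M : ℝ} (h : FiberBound f N M) {x : UnitSpace G}
    (ξ : HilbertFiber x) (T : Finset (SourceFiber x)) :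
    ∑ g ∈ T, ‖rhoFun x f ξ g‖ ^ 2 ≤ (N * M * ‖ξ‖) ^ 2 := by
  simp_rw [rhoFun_eq]
  exact schur_bound (fun g k : SourceFiber x => f (g.1 * k.1⁻¹)) N M (fun _ _ => h.norm_le _)
    (rhoFun_row h) (rhoFun_col h) ξ T

theorem rhoFun_memℓp [IsLocallyCompactEtale G] (x : UnitSpace G) (f : Cc G) (ξ : HilbertFiber x) :
    Memℓp (rhoFun x f ξ) 2 := by
  obtain ⟨N, M, h⟩ := exists_fiberBound f
  exact memℓp_gen' (C := (N * M * ‖ξ‖) ^ 2) fun T => by simpa using rhoFun_bound h ξ T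

/-- `ρ_x(f)` as a linear map. -/
def rhoLin [IsLocallyCompactEtale G] (x : UnitSpace G) (f : Cc G) :
    HilbertFiber x →ₗ[ℂ] HilbertFiber x where
  toFun ξ := ⟨rhoFun x f ξ, rhoFun_memℓp x f ξ⟩
  map_add' ξ η := by
    obtain ⟨N, M, h⟩ := exists_fiberBound f
    ext g
    change rhoFun x f (fun k => ξ k + η k) g = rhoFun x f ξ g + rhoFun x f η g
    simp only [rhoFun_eq]
    have hs : ∀ ζ : SourceFiber x → ℂ,
        Summable fun k : SourceFiber x => (f : G → ℂ) (g.1 * k.1⁻¹) * ζ k := fun ζ =>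
      summable_of_hasFiniteSupport ((Set.finite_of_encard_le_coe (rhoFun_row h g)).subset
        fun k hk => left_ne_zero_of_mul hk)
    rw [← (hs ξ).tsum_add (hs η)]
    simp_rw [mul_add]
  map_smul' c ξ := by
    ext g
    change rhoFun x f (fun k => c * ξ k) g = c * rhoFun x f ξ g
    simp only [rhoFun]
    rw [← tsum_mul_left]
    exact tsum_congr fun h => by ring

theorem norm_rhoLin_le [IsLocallyCompactEtale G] (x : UnitSpace G) (f : Cc G) {N : ℕ} {M : ℝ}
    (h : FiberBound (f : G → ℂ) N M) (ξ : HilbertFiber x) : ‖rhoLin x f ξ‖ ≤ N * M * ‖ξ‖ := by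
  have := h.nonneg x
  exact lp.norm_le_of_forall_sum_le (by norm_num) (by positivity) fun T => by
    have h1 := rhoFun_bound h ξ T
    simp only [ENNReal.toReal_ofNat, Real.rpow_ofNat]
    exact h1

/-- The bounded operator `ρ_x(f)` on `ℓ²(G_x)`, for `f ∈ C_c(G)`. -/
def rhoCc [IsLocallyCompactEtale G] (x : UnitSpace G) (f : Cc G) :
    HilbertFiber x →L[ℂ] HilbertFiber x :=
  ⟨rhoLin x f, by
    obtain ⟨N, M, h⟩ := exists_fiberBound f
    exact AddMonoidHomClass.continuous_of_bound (rhoLin x f) _ (norm_rhoLin_le x f h)⟩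

theorem rhoCc_memℓp [IsLocallyCompactEtale G] (f : Cc G) :
    Memℓp (fun x : UnitSpace G => rhoCc x f) ∞ := by
  obtain ⟨N, M, h⟩ := exists_fiberBound f
  refine memℓp_infty ⟨N * M, ?_⟩
  rintro _ ⟨x, rfl⟩
  have := h.nonneg x
  exact ContinuousLinearMap.opNorm_le_bound _ (by positivity) (norm_rhoLin_le x f h)

variable (G)

/-- The C⋆-algebra of bounded families in `∏_x B(ℓ²(G_x))`, with the supremum norm. -/
def OperatorProduct : Type u :=
  lp (fun x : UnitSpace G => HilbertFiber x →L[ℂ] HilbertFiber x) ∞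

instance : NonUnitalCStarAlgebra (OperatorProduct G) :=
  inferInstanceAs
    (NonUnitalCStarAlgebra (lp (fun x : UnitSpace G => HilbertFiber x →L[ℂ] HilbertFiber x) ∞))

variable {G} in
/-- The family `(ρ_x(f))_x`; its norm is `‖f‖_r = sup_x ‖ρ_x(f)‖`. -/
def rhoFamily [IsLocallyCompactEtale G] (f : Cc G) : OperatorProduct G :=
  ⟨fun x => rhoCc x f, rhoCc_memℓp f⟩

/-- The reduced C⋆-algebra `C*_r(G)`.  As `f ↦ (ρ_x(f))_x` is an isometry of `(C_c(G), ‖·‖_r)` into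
`OperatorProduct G` and a homomorphism for convolution and involution, the completion of `C_c(G)`
is the closed `*`-subalgebra generated by the image. -/
def reducedSubalgebra [IsLocallyCompactEtale G] : NonUnitalStarSubalgebra ℂ (OperatorProduct G) :=
  (NonUnitalStarAlgebra.adjoin ℂ (Set.range (rhoFamily (G := G)))).topologicalClosure

def ReducedCStarAlgebra [IsLocallyCompactEtale G] : Type u := reducedSubalgebra G

instance [IsLocallyCompactEtale G] : IsClosed (reducedSubalgebra G : Set (OperatorProduct G)) :=
  NonUnitalStarSubalgebra.isClosed_topologicalClosure _

instance [IsLocallyCompactEtale G] : NonUnitalCStarAlgebra (ReducedCStarAlgebra G) :=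
  inferInstanceAs (NonUnitalCStarAlgebra (reducedSubalgebra G))

variable {G}

/-- The projection of `OperatorProduct G` onto its factor `B(ℓ²(G_x))`. -/
def OperatorProduct.proj (x : UnitSpace G) :
    OperatorProduct G →⋆ₙₐ[ℂ] (HilbertFiber x →L[ℂ] HilbertFiber x) where
  toFun a := a.1 x
  map_smul' _ _ := rfl
  map_zero' := rfl
  map_add' _ _ := rfl
  map_mul' _ _ := rfl
  map_star' _ := rfl

/-- The representation `ρ_x` of `C*_r(G)` on `ℓ²(G_x)`, extending `rhoCc x` on `C_c(G)`. -/
def rho [IsLocallyCompactEtale G] (x : UnitSpace G) :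
    ReducedCStarAlgebra G →⋆ₙₐ[ℂ] (HilbertFiber x →L[ℂ] HilbertFiber x) :=
  (OperatorProduct.proj x).comp (NonUnitalStarSubalgebraClass.subtype (reducedSubalgebra G))

end Etale

section Representations
variable {A : Type u} [NonUnitalCStarAlgebra A]

/-- The Hilbert space direct sum `⊕_i π_i` of representations of a C⋆-algebra. -/
def directSum {ι : Type v} {H : ι → Type u} [∀ i, NormedAddCommGroup (H i)]
    [∀ i, InnerProductSpace ℂ (H i)] [∀ i, CompleteSpace (H i)]
    (π : ∀ i, A →⋆ₙₐ[ℂ] (H i →L[ℂ] H i)) : A →⋆ₙₐ[ℂ] (lp H 2 →L[ℂ] lp H 2) :=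
  have hle : ∀ (a : A) (ξ : lp H 2) (i : ι), ‖π i a (ξ i)‖ ≤ ‖((‖a‖ : ℂ) • ξ) i‖ := fun a ξ i => by
    rw [lp.coeFn_smul, Pi.smul_apply, norm_smul, Complex.norm_real, norm_norm]
    refine ((π i a).le_opNorm _).trans ?_
    gcongr
    exact NonUnitalStarAlgHom.norm_apply_le (π i) a
  let T : A → lp H 2 → lp H 2 := fun a ξ =>
    ⟨fun i => π i a (ξ i), (lp.memℓp ((‖a‖ : ℂ) • ξ)).mono' (hle a ξ)⟩
  have hT : ∀ a ξ, ‖T a ξ‖ ≤ ‖a‖ * ‖ξ‖ := fun a ξ => by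
    have h1 : ‖T a ξ‖ ≤ ‖(‖a‖ : ℂ) • ξ‖ := lp.norm_mono (by norm_num) (hle a ξ)
    rwa [norm_smul, Complex.norm_real, norm_norm] at h1
  { toFun := fun a => LinearMap.mkContinuous
      { toFun := T a
        map_add' := fun ξ η => by
          ext i
          exact map_add (π i a) (ξ i) (η i)
        map_smul' := fun c ξ => by
          ext i
          exact map_smul (π i a) c (ξ i) } ‖a‖ (hT a)
    map_smul' := fun c a => by
      ext ξ i
      change π i (c • a) (ξ i) = c • π i a (ξ i)
      rw [map_smul]
      rfl
    map_zero' := by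
      ext ξ i
      change π i 0 (ξ i) = 0
      rw [map_zero]
      rfl
    map_add' := fun a b => by
      ext ξ i
      change π i (a + b) (ξ i) = π i a (ξ i) + π i b (ξ i)
      rw [map_add]
      rfl
    map_mul' := fun a b => by
      ext ξ i
      change π i (a * b) (ξ i) = π i a (π i b (ξ i))
      rw [map_mul]
      rfl
    map_star' := fun a => by
      rw [ContinuousLinearMap.star_eq_adjoint, ContinuousLinearMap.eq_adjoint_iff]
      intro ξ η
      rw [lp.inner_eq_tsum, lp.inner_eq_tsum]
      refine tsum_congr fun i => ?_
      change inner ℂ (π i (star a) (ξ i)) (η i) = inner ℂ (ξ i) (π i a (η i))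
      rw [map_star, ContinuousLinearMap.star_eq_adjoint, ContinuousLinearMap.adjoint_inner_left] }

/-- A representation `π` of a C⋆-algebra `A` is weakly contained in a representation `σ` of `A` if
`ker σ ⊆ ker π`. -/
def WeaklyContained {H K : Type*} [NormedAddCommGroup H] [InnerProductSpace ℂ H] [CompleteSpace H]
    [NormedAddCommGroup K] [InnerProductSpace ℂ K] [CompleteSpace K]
    (π : A →⋆ₙₐ[ℂ] (H →L[ℂ] H)) (σ : A →⋆ₙₐ[ℂ] (K →L[ℂ] K)) : Prop :=
  ∀ a : A, σ a = 0 → π a = 0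

end Representations

section Criterion
variable {G : Type u} [TopologicalSpace G] [ArrowGroupoid G]

/-- `Y ⊆ G⁽⁰⁾` is `G`-invariant. -/
def GroupoidInvariant (Y : Set (UnitSpace G)) : Prop := ∀ g : G, src g ∈ Y ↔ rng g ∈ Y

/-- An open bisection: an open set on which the source and range maps are injective (hence, in an
étale groupoid, homeomorphisms onto open subsets of `G⁽⁰⁾`). -/
def IsOpenBisection (U : Set G) : Prop :=
  IsOpen U ∧ Set.InjOn (src : G → UnitSpace G) U ∧ Set.InjOn (rng : G → UnitSpace G) U

/-- Near `x`, the set `Y` is covered by finitely many open bisections around nontrivial elements of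
the isotropy group of `x`. -/
def CoveredNear (Y : Set (UnitSpace G)) (x : UnitSpace G) : Prop :=
  ∃ n : ℕ, 1 ≤ n ∧ ∃ (g : Fin n → Isotropy x) (B : Fin n → Set G) (U : Set (UnitSpace G)),
    (∀ k, g k ≠ 1 ∧ IsOpenBisection (B k) ∧ (g k : G) ∈ B k) ∧ U ∈ 𝓝 x ∧
      ∀ y ∈ Y ∩ U, (y : G) ∈ ⋃ k, B k

/-- There is a net in `Y` whose only accumulation point in the isotropy group of `x` (with respect
to the topology of `G`) is `x`. -/
def ExistsNetUniqueAcc (Y : Set (UnitSpace G)) (x : UnitSpace G) : Prop :=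
  ∃ (ι : Type u) (_ : Preorder ι) (_ : IsDirectedOrder ι) (_ : Nonempty ι) (y : ι → UnitSpace G),
    (∀ i, y i ∈ Y) ∧
      ∀ g : Isotropy x, MapClusterPt (g : G) atTop (fun i => (y i : G)) ↔ g = 1

/-- `∑_k 1/|G_k| < 1` for every finite set of distinct nontrivial cyclic subgroups `G_k` of `Γ`.
For infinite `G_k` one has `Nat.card G_k = 0`, so the summand is `0 = 1/∞`. -/
def FewCyclicSubgroups (Γ : Type*) [Group Γ] : Prop :=
  ∀ F : Finset (Subgroup Γ), (∀ C ∈ F, IsCyclic C ∧ C ≠ ⊥) →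
    ∑ C ∈ F, (1 : ℝ) / (Nat.card C : ℝ) < 1

end Criterion

end EtaleGroupoid

end

open EtaleGroupoid

/-! Consider the filter on `G⁽⁰⁾` generated by the neighbourhoods of `x` in `Y` and the complements
of the open bisections around nontrivial elements of the isotropy group of `x`. It is proper exactly
when (*) fails, and exactly when a net as in the last claim exists. Along it `y → x` without any
other accumulation point in `G`, so `f(y) → f(x)` for all `f ∈ C_c(G)`, even though `f` need not be
continuous; hence the vector state of `ρ_x` at the cyclic vector `δ_x` is a limit of the vector
states of the `ρ_y` at `δ_y`, which gives weak containment.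

Conversely, if `y ∈ Y` is close to `x` and lies in a bisection around `g ∈ G_x^x`, then `y` is close
to every element of the cyclic group generated by `g`. So under (*) there are finitely many
nontrivial cyclic subgroups `G_k` such that, for any finite `S_k ⊆ G_k`, each `y ∈ Y` near `x` lies
in prescribed bisections around all elements of some `S_k`. Let `f_k` be the average over `S_k` of
the lifts to these bisections of a bump function at `x`, and `f_0` its lift to the units. Then
`∑ f_k^* * f_k - f_0^* * f_0` is positive in every `ρ_y`, `y ∈ Y`, while its expectation at `δ_x` is
`∑ 1 / |S_k| - 1`, which is negative for large enough `S_k`. -/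

namespace EtaleGroupoid

open Filter Topology ArrowGroupoid
open scoped lp Pointwise CompactlySupported

section Topology
variable {X : Type*} [TopologicalSpace X]

/-- `f` vanishes off a compact subset of `B` and is continuous on `B`: for open `B`, the extension
by zero of an element of `C_c(B)`, where compactness replaces closedness of the support since `X`
need not be Hausdorff. -/
def CompactlySupportedOn (B : Set X) (f : X → ℂ) : Prop :=
  ContinuousOn f B ∧ ∃ K ⊆ B, IsCompact K ∧ ∀ z ∉ K, f z = 0

theorem CompactlySupportedOn.eq_zero {B : Set X} {f : X → ℂ} (hf : CompactlySupportedOn B f)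
    {z : X} (hz : z ∉ B) : f z = 0 :=
  let ⟨_, _, hKB, _, hK⟩ := hf
  hK z fun hzK => hz (hKB hzK)

theorem compactlySupportedOn_extend {V B : Set X} {F : V → ℂ} (hF : Continuous F)
    (hc : HasCompactSupport F) (hB : tsupport F ⊆ Subtype.val ⁻¹' B) :
    CompactlySupportedOn (V ∩ B) (Function.extend Subtype.val F 0) := by
  have hval : ∀ v : V, Function.extend Subtype.val F 0 (v : X) = F v :=
    Subtype.val_injective.extend_apply F 0
  refine ⟨ContinuousOn.mono ?_ Set.inter_subset_left, Subtype.val '' tsupport F, ?_,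
    hc.image continuous_subtype_val, fun z hz => ?_⟩
  · rw [continuousOn_iff_continuous_domRestrict]
    exact hF.congr fun v => (hval v).symm
  · rintro _ ⟨v, hv, rfl⟩
    exact ⟨v.2, hB hv⟩
  · by_cases hzV : z ∈ V
    · refine (hval ⟨z, hzV⟩).trans (image_eq_zero_of_notMem_tsupport fun h => hz ⟨_, h, rfl⟩)
    · exact Function.extend_apply' _ _ _ fun ⟨v, hv⟩ => hzV (hv ▸ v.2)

theorem exists_eq_sum_of_tsupport_subset_iUnion [T2Space X] [LocallyCompactSpace X] {E ι : Type*}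
    [AddCommGroup E] [Module ℝ E] [TopologicalSpace E] [ContinuousSMul ℝ E] {U : ι → Set X}
    (hU : ∀ i, IsOpen (U i)) {f : X → E} (hf : Continuous f) (hc : HasCompactSupport f)
    (hfU : tsupport f ⊆ ⋃ i, U i) :
    ∃ (n : ℕ) (F : Fin n → X → E), f = ∑ k, F k ∧
      ∀ k, Continuous (F k) ∧ HasCompactSupport (F k) ∧ ∃ i, tsupport (F k) ⊆ U i := by
  obtain ⟨t, ht⟩ := hc.isCompact.elim_finite_subcover U hU hfU
  let i (k : Fin t.card) : ι := t.equivFin.symm k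
  have hcover : tsupport f ⊆ ⋃ k, U (i k) := fun z hz => by
    obtain ⟨j, hj, hzj⟩ := Set.mem_iUnion₂.1 (ht hz)
    exact Set.mem_iUnion.2 ⟨t.equivFin ⟨j, hj⟩, by simpa [i] using hzj⟩
  obtain ⟨p, hpU, hp1, -, -⟩ :=
    exists_continuous_sum_one_of_isOpen_isCompact (fun k => hU (i k)) hc.isCompact hcover
  refine ⟨t.card, fun k z => p k z • f z, funext fun z => ?_, fun k =>
    ⟨(p k).continuous.smul hf, hc.smul_left, i k, (tsupport_smul_subset_left _ _).trans (hpU k)⟩⟩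
  rw [Finset.sum_apply, ← Finset.sum_smul]
  by_cases hz : z ∈ tsupport f
  · simpa using congrArg (· • f z) (hp1 hz).symm
  · simp [image_eq_zero_of_notMem_tsupport hz]

end Topology

theorem exists_net_tendsto {X : Type u} (l : Filter X) [l.NeBot] :
    ∃ (ι : Type u) (_ : Preorder ι) (_ : IsDirectedOrder ι) (_ : Nonempty ι) (y : ι → X),
      Tendsto y atTop l := by
  let ι : Type u := {p : Set X × X // p.1 ∈ l ∧ p.2 ∈ p.1}
  let _ : Preorder ι := Preorder.lift fun p => OrderDual.toDual p.1.1
  have hle {p q : ι} : p ≤ q ↔ q.1.1 ⊆ p.1.1 := Iff.rfl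
  have hex (s : Set X) (hs : s ∈ l) : ∃ p : ι, p.1.1 = s :=
    let ⟨y, hy⟩ := nonempty_of_mem hs
    ⟨⟨(s, y), hs, hy⟩, rfl⟩
  refine ⟨ι, inferInstance, ⟨fun p q => ?_⟩, ⟨(hex _ univ_mem).choose⟩, fun p => p.1.2,
    fun s hs => ?_⟩
  · obtain ⟨r, hr⟩ := hex _ (inter_mem p.2.1 q.2.1)
    exact ⟨r, hle.2 (hr ▸ Set.inter_subset_left), hle.2 (hr ▸ Set.inter_subset_right)⟩
  · obtain ⟨p, rfl⟩ := hex s hs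
    exact mem_map.2 (mem_of_superset (Ici_mem_atTop p) fun q hq => hle.1 hq q.2.2)

section FiniteSubsets
variable {X : Type*}

theorem exists_finset_one_div_card_le {s : Set X} (hs : s.Nonempty) {ε : ℝ} (hε : 0 < ε) :
    ∃ T : Finset X, (T.Nonempty ∧ (T : Set X) ⊆ s) ∧ (1 : ℝ) / T.card ≤ 1 / Nat.card s + ε := by
  rcases s.finite_or_infinite with hfin | hinf
  · refine ⟨hfin.toFinset, by simpa using hs, ?_⟩
    rw [Nat.card_eq_card_finite_toFinset hfin]
    exact le_add_of_nonneg_right hε.le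
  · obtain ⟨n, hn⟩ := exists_nat_one_div_lt hε
    obtain ⟨T, hT, hcard⟩ := hinf.exists_subset_card_eq (n + 1)
    refine ⟨T, ⟨Finset.card_pos.1 (by lia), hT⟩, ?_⟩
    rw [hcard, Nat.cast_succ]
    exact le_add_of_nonneg_of_le (by positivity) hn.le

theorem exists_finsets_sum_one_div_card_lt {α : Type*} (F : Finset α) {s : α → Set X}
    (hs : ∀ i, (s i).Nonempty) {c : ℝ} (h : ∑ i ∈ F, (1 : ℝ) / Nat.card (s i) < c) :
    ∃ S : α → Finset X, (∀ i, (S i).Nonempty ∧ (S i : Set X) ⊆ s i) ∧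
      ∑ i ∈ F, (1 : ℝ) / (S i).card < c := by
  set δ : ℝ := c - ∑ i ∈ F, (1 : ℝ) / Nat.card (s i)
  have hδ : 0 < δ := sub_pos.2 h
  choose S hS hcard using fun i =>
    exists_finset_one_div_card_le (hs i) (ε := δ / (F.card + 1)) (by positivity)
  refine ⟨S, hS, ?_⟩
  calc ∑ i ∈ F, (1 : ℝ) / (S i).card
      ≤ ∑ i ∈ F, (1 / Nat.card (s i) + δ / (F.card + 1)) := Finset.sum_le_sum fun i _ => hcard i
    _ = c - δ + F.card / (F.card + 1) * δ := by
      rw [Finset.sum_add_distrib, Finset.sum_const, nsmul_eq_mul]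
      ring
    _ < c := by
      have : F.card / (F.card + 1 : ℝ) < 1 := (div_lt_one (by positivity)).2 (lt_add_one _)
      nlinarith

end FiniteSubsets

section EllTwo
variable {ι : Type*}

/-- The standard Hilbert basis `(δ_k)` of `ℓ²(ι)`. -/
noncomputable def delta : HilbertBasis ι ℂ ℓ²(ι, ℂ) := ⟨.refl ℂ _⟩

theorem inner_delta_left (k : ι) (ξ : ℓ²(ι, ℂ)) : inner ℂ (delta k) ξ = ξ k :=
  (delta.repr_apply_apply ξ k).symm

theorem norm_delta (k : ι) : ‖(delta k : ℓ²(ι, ℂ))‖ = 1 := delta.orthonormal.1 k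

open Classical in
theorem delta_apply (k i : ι) : (delta k : ℓ²(ι, ℂ)) i = if i = k then 1 else 0 := by
  rw [← inner_delta_left, orthonormal_iff_ite.1 delta.orthonormal]

theorem operator_ext {E : Type*} [NormedAddCommGroup E] [NormedSpace ℂ E]
    {S T : ℓ²(ι, ℂ) →L[ℂ] E} (h : ∀ k, S (delta k) = T (delta k)) : S = T :=
  ContinuousLinearMap.ext_on
    (Submodule.dense_iff_topologicalClosure_eq_top.2 delta.dense_span) (Set.forall_mem_range.2 h)

theorem norm_sum_delta_sq (T : Finset ι) : ‖(∑ k ∈ T, delta k : ℓ²(ι, ℂ))‖ ^ 2 = T.card := by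
  have h := (delta (ι := ι)).orthonormal.inner_sum (fun _ => (1 : ℂ)) (fun _ => 1) T
  simp only [one_smul, map_one, mul_one, Finset.sum_const, nsmul_eq_mul,
    inner_self_eq_norm_sq_to_K, Complex.coe_algebraMap] at h
  exact_mod_cast h

theorem norm_sq_le_sum_norm_sq {α : Type*} (F : Finset α) (ξ : ℓ²(ι, ℂ)) (η : α → ℓ²(ι, ℂ))
    (h : ∀ k, ‖ξ k‖ ^ 2 ≤ ∑ i ∈ F, ‖η i k‖ ^ 2) : ‖ξ‖ ^ 2 ≤ ∑ i ∈ F, ‖η i‖ ^ 2 := by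
  have hasSum_norm_sq (ζ : ℓ²(ι, ℂ)) : HasSum (fun k => ‖ζ k‖ ^ 2) (‖ζ‖ ^ 2) := by
    simpa using lp.hasSum_norm (p := 2) (by norm_num) ζ
  exact hasSum_le h (hasSum_norm_sq ξ) (hasSum_sum fun i _ => hasSum_norm_sq (η i))

end EllTwo

section CStarAlgebra
variable {A : Type u} [NonUnitalCStarAlgebra A] {H : Type*} [NormedAddCommGroup H]
  [InnerProductSpace ℂ H] [CompleteSpace H]

open scoped CStarAlgebra in
theorem map_nonneg_iff_map_negPart_eq_zero (π : A →⋆ₙₐ[ℂ] (H →L[ℂ] H)) {a : A}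
    (ha : IsSelfAdjoint a) : 0 ≤ π a ↔ π a⁻ = 0 := by
  have hneg : π a⁻ = (π a)⁻ :=
    NonUnitalStarAlgHom.map_cfcₙ (R := ℝ) (S := ℂ) π _ a (by fun_prop) (by simp)
      (map_continuous π) ha (ha.map π)
  rw [hneg, CFC.negPart_eq_zero_iff (π a) (ha.map π)]

theorem isSelfAdjoint_sum_star_mul_sub {α : Type*} (F : Finset α) (b : α → A) (c : A) :
    IsSelfAdjoint (∑ i ∈ F, star (b i) * b i - star c * c) :=
  (isSelfAdjoint_sum F fun i _ => .star_mul_self (b i)).sub (.star_mul_self c)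

theorem map_sum_star_mul_sub_nonneg_iff (π : A →⋆ₙₐ[ℂ] (H →L[ℂ] H)) {α : Type*} (F : Finset α)
    (b : α → A) (c : A) :
    0 ≤ π (∑ i ∈ F, star (b i) * b i - star c * c) ↔
      ∀ ξ, ‖π c ξ‖ ^ 2 ≤ ∑ i ∈ F, ‖π (b i) ξ‖ ^ 2 := by
  have hinner (d : A) (ξ : H) : (inner ℂ (π (star d) (π d ξ)) ξ).re = ‖π d ξ‖ ^ 2 := by
    rw [map_star, ContinuousLinearMap.star_eq_adjoint, ContinuousLinearMap.adjoint_inner_left]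
    exact inner_self_eq_norm_sq (𝕜 := ℂ) _
  have hform (ξ : H) :
      (π (∑ i ∈ F, star (b i) * b i - star c * c)).reApplyInnerSelf ξ =
        ∑ i ∈ F, ‖π (b i) ξ‖ ^ 2 - ‖π c ξ‖ ^ 2 := by
    simp [ContinuousLinearMap.reApplyInnerSelf, inner_sub_left, sum_inner, hinner]
  rw [ContinuousLinearMap.nonneg_iff_isPositive, ContinuousLinearMap.isPositive_def']
  simp only [hform, sub_nonneg]
  exact and_iff_right ((isSelfAdjoint_sum_star_mul_sub F b c).map π)

variable {ι : Type v} {K : ι → Type u} [∀ i, NormedAddCommGroup (K i)]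
  [∀ i, InnerProductSpace ℂ (K i)] [∀ i, CompleteSpace (K i)]

theorem directSum_eq_zero_iff (σ : ∀ i, A →⋆ₙₐ[ℂ] (K i →L[ℂ] K i)) (a : A) :
    directSum σ a = 0 ↔ ∀ i, σ i a = 0 := by
  classical
  have hcoord (ξ : lp K 2) (i : ι) : directSum σ a ξ i = σ i a (ξ i) := rfl
  refine ⟨fun h i => ContinuousLinearMap.ext fun ξ => ?_, fun h => ?_⟩
  · simpa [h] using (hcoord (lp.single 2 i ξ) i).symm
  · ext ξ i
    simp [hcoord, h]

/-- Positivity passes through weak containment because it is vanishing of the negative part. -/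
theorem WeaklyContained.norm_sq_le_sum {π : A →⋆ₙₐ[ℂ] (H →L[ℂ] H)}
    {σ : ∀ i, A →⋆ₙₐ[ℂ] (K i →L[ℂ] K i)} (h : WeaklyContained π (directSum σ)) {α : Type*}
    (F : Finset α) (b : α → A) (c : A)
    (hσ : ∀ i ξ, ‖σ i c ξ‖ ^ 2 ≤ ∑ j ∈ F, ‖σ i (b j) ξ‖ ^ 2) (ξ : H) :
    ‖π c ξ‖ ^ 2 ≤ ∑ j ∈ F, ‖π (b j) ξ‖ ^ 2 := by
  have ha := isSelfAdjoint_sum_star_mul_sub F b c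
  have hneg : directSum σ (∑ j ∈ F, star (b j) * b j - star c * c)⁻ = 0 :=
    (directSum_eq_zero_iff σ _).2 fun i => (map_nonneg_iff_map_negPart_eq_zero (σ i) ha).1
      ((map_sum_star_mul_sub_nonneg_iff (σ i) F b c).2 (hσ i))
  exact (map_sum_star_mul_sub_nonneg_iff π F b c).1
    ((map_nonneg_iff_map_negPart_eq_zero π ha).2 (h _ hneg)) ξ

end CStarAlgebra

section Arrows
variable {G : Type u} [ArrowGroupoid G]

theorem rng_mul_self (g : G) : (rng g : G) * g = g := range_mul_self g

theorem mul_src_self (g : G) : g * src g = g := mul_source g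

theorem inv_mul_cancel_left_of {a b : G} (h : src a = rng b) : a⁻¹ * (a * b) = b := by
  rw [← mul_assoc_of (src_inv a) h, inv_mul_self, source_of_src h]
  exact rng_mul_self b

theorem mul_inv_cancel_right_of {a b : G} (h : src a = rng b) : a * b * b⁻¹ = a := by
  rw [mul_assoc_of h (rng_inv b).symm, mul_inv_self, range_of_rng h.symm]
  exact mul_src_self a

theorem eq_inv_of_mul_eq_rng {a b : G} (h : src a = rng b) (hab : a * b = rng a) : b = a⁻¹ := by
  rw [← inv_mul_cancel_left_of h, hab, ← src_inv, mul_src_self]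

theorem inv_inv_of (g : G) : g⁻¹⁻¹ = g :=
  (eq_inv_of_mul_eq_rng (src_inv g) ((inv_mul_self g).trans (range_inv g).symm)).symm

theorem mul_inv_cancel_left_of {a b : G} (h : rng a = rng b) : a * (a⁻¹ * b) = b := by
  simpa only [inv_inv_of] using inv_mul_cancel_left_of ((src_inv a).trans h)

theorem inv_mul_cancel_right_of {a b : G} (h : src a = src b) : a * b⁻¹ * b = a := by
  simpa only [inv_inv_of] using mul_inv_cancel_right_of (h.trans (rng_inv b).symm)

theorem mul_inv_rev_of {a b : G} (h : src a = rng b) : (a * b)⁻¹ = b⁻¹ * a⁻¹ := by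
  have hinv : src b⁻¹ = rng a⁻¹ := by rw [src_inv, rng_inv, h]
  have hmul : src (a * b) = rng b⁻¹ := by rw [src_mul h, rng_inv]
  refine (eq_inv_of_mul_eq_rng (hmul.trans (rng_mul hinv).symm) ?_).symm
  rw [← mul_assoc_of hmul hinv, mul_inv_cancel_right_of h, mul_inv_self, rng_mul h]
  rfl

theorem UnitSpace.mul_self (y : UnitSpace G) : (y : G) * y = y := by
  simpa only [src_coe] using mul_src_self (y : G)

theorem UnitSpace.inv_coe (y : UnitSpace G) : (y : G)⁻¹ = y :=
  (eq_inv_of_mul_eq_rng ((src_coe y).trans (rng_coe y).symm) (by rw [y.mul_self, rng_coe])).symm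

theorem mul_unit_inv {y : UnitSpace G} {g : G} (h : src g = y) : g * (y : G)⁻¹ = g := by
  rw [y.inv_coe, ← h, mul_src_self]

/-- The product `AB = {ab : a ∈ A, b ∈ B, s(a) = r(b)}` of sets of arrows; unlike the pointwise
product it ignores the values of the multiplication on noncomposable pairs. -/
def composableMul (A B : Set G) : Set G :=
  (fun p : G × G => p.1 * p.2) '' (A ×ˢ B ∩ {p | src p.1 = rng p.2})

end Arrows

section Topology
variable {G : Type u} [TopologicalSpace G] [ArrowGroupoid G] [IsLocallyCompactEtale G]

instance : T2Space (UnitSpace G) := IsLocallyCompactEtale.unitSpace_t2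

instance : LocallyCompactSpace (UnitSpace G) := IsLocallyCompactEtale.unitSpace_locallyCompact

theorem continuous_src : Continuous (src : G → UnitSpace G) :=
  IsLocallyCompactEtale.isLocalHomeomorph_src.continuous

theorem continuous_rng : Continuous (rng : G → UnitSpace G) :=
  IsLocallyCompactEtale.isLocalHomeomorph_rng.continuous

theorem isOpenMap_src : IsOpenMap (src : G → UnitSpace G) :=
  IsLocallyCompactEtale.isLocalHomeomorph_src.isOpenMap

theorem isOpenEmbedding_unitSpace_coe : IsOpenEmbedding ((↑) : UnitSpace G → G) :=
  IsLocallyCompactEtale.isLocalHomeomorph_src.isOpenEmbedding_of_comp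
    ((funext src_coe : src ∘ ((↑) : UnitSpace G → G) = id) ▸ .id) continuous_subtype_val

theorem exists_isOpenBisection (g : G) : ∃ B : Set G, IsOpenBisection B ∧ g ∈ B := by
  obtain ⟨e, hge, he⟩ := IsLocallyCompactEtale.isLocalHomeomorph_src (G := G) g
  obtain ⟨e', hge', he'⟩ := IsLocallyCompactEtale.isLocalHomeomorph_rng (G := G) g
  exact ⟨e.source ∩ e'.source, ⟨e.open_source.inter e'.open_source,
    he ▸ e.injOn.mono Set.inter_subset_left, he' ▸ e'.injOn.mono Set.inter_subset_right⟩, hge, hge'⟩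

theorem isOpenBisection_range_coe : IsOpenBisection (Set.range ((↑) : UnitSpace G → G)) := by
  refine ⟨isOpenEmbedding_unitSpace_coe.isOpen_range, ?_, ?_⟩ <;>
    rintro _ ⟨(y : UnitSpace G), rfl⟩ _ ⟨(z : UnitSpace G), rfl⟩ h
  · rw [← src_coe y, h, src_coe]
  · rw [← rng_coe y, h, rng_coe]

theorem tendsto_mul {ι : Type*} {l : Filter ι} {a b : ι → G} {g h : G} (ha : Tendsto a l (𝓝 g))
    (hb : Tendsto b l (𝓝 h)) (hab : ∀ᶠ i in l, src (a i) = rng (b i)) (hgh : src g = rng h) :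
    Tendsto (fun i => a i * b i) l (𝓝 (g * h)) :=
  (IsLocallyCompactEtale.continuousOn_mul (g, h) hgh).tendsto.comp
    (tendsto_nhdsWithin_iff.2 ⟨ha.prodMk_nhds hb, hab⟩)

theorem isCompact_composableMul {K L : Set G} (hK : IsCompact K) (hL : IsCompact L) :
    IsCompact (composableMul K L) :=
  ((hK.prod hL).inter_right (isClosed_eq (continuous_src.comp continuous_fst)
    (continuous_rng.comp continuous_snd))).image_of_continuousOn
      (IsLocallyCompactEtale.continuousOn_mul.mono Set.inter_subset_right)

end Topology

namespace IsOpenBisection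
variable {G : Type u} [TopologicalSpace G] [ArrowGroupoid G]

theorem mono {B B' : Set G} (hB : IsOpenBisection B) (hB' : IsOpen B') (h : B' ⊆ B) :
    IsOpenBisection B' :=
  ⟨hB', hB.2.1.mono h, hB.2.2.mono h⟩

variable [IsLocallyCompactEtale G]

theorem inv {B : Set G} (hB : IsOpenBisection B) : IsOpenBisection B⁻¹ := by
  refine ⟨hB.1.preimage IsLocallyCompactEtale.continuous_inv, fun g hg h hh e => ?_,
    fun g hg h hh e => ?_⟩
  · rw [← inv_inv_of g, hB.2.2 hg hh (by rwa [rng_inv, rng_inv]), inv_inv_of]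
  · rw [← inv_inv_of g, hB.2.1 hg hh (by rwa [src_inv, src_inv]), inv_inv_of]

theorem isOpenEmbedding_src {B : Set G} (hB : IsOpenBisection B) :
    IsOpenEmbedding fun b : B => (src b.1 : UnitSpace G) :=
  (IsLocallyCompactEtale.isLocalHomeomorph_src.comp
    hB.1.isOpenEmbedding_subtypeVal.isLocalHomeomorph).isOpenEmbedding_of_injective
      hB.2.1.injective

end IsOpenBisection

/-- The section of the source map with values in a bisection `B`; off `s(B)` its values, the
units, are irrelevant. -/
noncomputable def sourceSection {G : Type u} [ArrowGroupoid G] (B : Set G) : UnitSpace G → G :=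
  Function.extend (fun b : B => (src b.1 : UnitSpace G)) (↑) (↑)

/-- For `g = ab` with `b` in the bisection `B`, the pair `(a, b)`. -/
noncomputable def factors {G : Type u} [ArrowGroupoid G] (B : Set G) (g : G) : G × G :=
  (g * (sourceSection B (src g))⁻¹, sourceSection B (src g))

namespace IsOpenBisection
variable {G : Type u} [TopologicalSpace G] [ArrowGroupoid G] {A B : Set G}

theorem sourceSection_src (hB : IsOpenBisection B) {b : G} (hb : b ∈ B) :
    sourceSection B (src b) = b :=
  hB.2.1.injective.extend_apply _ _ (⟨b, hb⟩ : B)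

theorem factors_mul (hB : IsOpenBisection B) {a b : G} (h : src a = rng b) (hb : b ∈ B) :
    factors B (a * b) = (a, b) := by
  rw [factors, src_mul h, hB.sourceSection_src hb, mul_inv_cancel_right_of h]

variable [IsLocallyCompactEtale G]

theorem continuousOn_sourceSection (hB : IsOpenBisection B) :
    ContinuousOn (sourceSection B) (src '' B) := by
  rintro _ ⟨b, hb, rfl⟩
  refine ContinuousAt.continuousWithinAt ((hB.isOpenEmbedding_src.continuousAt_iff
    (x := ⟨b, hb⟩)).1 (ContinuousAt.congr continuous_subtype_val.continuousAt ?_))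
  exact .of_forall fun c => (hB.sourceSection_src c.2).symm

theorem continuousOn_factors (hB : IsOpenBisection B) :
    ContinuousOn (factors B) (src ⁻¹' (src '' B)) := by
  have hright : ContinuousOn (fun g : G => sourceSection B (src g)) (src ⁻¹' (src '' B)) :=
    hB.continuousOn_sourceSection.comp continuous_src.continuousOn (Set.mapsTo_preimage _ _)
  have hleft := IsLocallyCompactEtale.continuousOn_mul.comp
    (continuousOn_id.prodMk (IsLocallyCompactEtale.continuous_inv.comp_continuousOn hright)) ?_
  · exact hleft.prodMk hright
  · rintro g ⟨b, hb, e⟩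
    change src g = rng (sourceSection B (src g))⁻¹
    rw [← e, hB.sourceSection_src hb, rng_inv]

theorem mul (hA : IsOpenBisection A) (hB : IsOpenBisection B) :
    IsOpenBisection (composableMul A B) := by
  refine ⟨?_, ?_, ?_⟩
  · have heq : composableMul A B = src ⁻¹' (src '' B) ∩ factors B ⁻¹' (A ×ˢ Set.univ) := by
      ext g
      constructor
      · rintro ⟨⟨a, b⟩, ⟨⟨ha, hb⟩, h⟩, rfl⟩
        refine ⟨⟨b, hb, (src_mul h).symm⟩, ?_⟩
        rw [Set.mem_preimage, hB.factors_mul h hb]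
        exact ⟨ha, trivial⟩
      · rintro ⟨⟨b, hb, e⟩, hg⟩
        rw [Set.mem_preimage, factors, ← e, hB.sourceSection_src hb] at hg
        refine ⟨(g * b⁻¹, b), ⟨⟨hg.1, hb⟩, ?_⟩, inv_mul_cancel_right_of e.symm⟩
        exact (src_mul (e.symm.trans (rng_inv b).symm)).trans (src_inv b)
    rw [heq]
    exact hB.continuousOn_factors.isOpen_inter_preimage
      ((isOpenMap_src B hB.1).preimage continuous_src) (hA.1.prod isOpen_univ)
  · rintro _ ⟨⟨a, b⟩, ⟨⟨ha, hb⟩, h⟩, rfl⟩ _ ⟨⟨a', b'⟩, ⟨⟨ha', hb'⟩, h'⟩, rfl⟩ e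
    have hbb : b = b' := hB.2.1 hb hb' (by rwa [src_mul h, src_mul h'] at e)
    have haa : a = a' := hA.2.1 ha ha' (by rw [h, h', hbb])
    rw [haa, hbb]
  · rintro _ ⟨⟨a, b⟩, ⟨⟨ha, hb⟩, h⟩, rfl⟩ _ ⟨⟨a', b'⟩, ⟨⟨ha', hb'⟩, h'⟩, rfl⟩ e
    have haa : a = a' := hA.2.2 ha ha' (by rwa [rng_mul h, rng_mul h'] at e)
    have hbb : b = b' := hB.2.2 hb hb' (by rw [← h, ← h', haa])
    rw [haa, hbb]

end IsOpenBisection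

section Cc
variable {G : Type u} [TopologicalSpace G] [ArrowGroupoid G] [IsLocallyCompactEtale G]

theorem CompactlySupportedOn.mem_Cc {B : Set G} (hB : IsOpenBisection B) {f : G → ℂ}
    (hf : CompactlySupportedOn B f) : f ∈ Cc G := by
  have hT2 := hB.isOpenEmbedding_src.isEmbedding.t2Space
  obtain ⟨hc, K, hKB, hK, hKf⟩ := id hf
  exact Submodule.subset_span ⟨B, hB.1, hT2, continuousOn_iff_continuous_domRestrict.1 hc,
    .intro ((IsInducing.subtypeVal.isCompact_preimage_iff (by simpa using hKB)).2 hK)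
      fun b hb => hKf b hb, fun g hg => hf.eq_zero hg⟩

variable (G) in
/-- The elements of `C_c(G)` that are compactly supported on a single open bisection. -/
def bisectionFunctions : Set (Cc G) :=
  {f | ∃ B, IsOpenBisection B ∧ CompactlySupportedOn B (f : G → ℂ)}

theorem span_bisectionFunctions : Submodule.span ℂ (bisectionFunctions G) = ⊤ := by
  refine Submodule.map_injective_of_injective (Cc G).injective_subtype (le_antisymm ?_ ?_)
  · exact Submodule.map_mono le_top
  rw [Submodule.map_span, Submodule.map_top, Submodule.range_subtype]
  refine Submodule.span_le.2 ?_
  rintro f ⟨V, hV, _, hf, hc, hfV⟩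
  have : LocallyCompactSpace G := IsLocallyCompactEtale.locallyCompactSpace
  have : LocallyCompactSpace V := hV.locallyCompactSpace
  choose B hB hgB using exists_isOpenBisection (G := G)
  obtain ⟨n, F, hfF, hF⟩ := exists_eq_sum_of_tsupport_subset_iUnion
    (fun g => (hB g).1.preimage continuous_subtype_val) hf hc
    fun v _ => Set.mem_iUnion.2 ⟨(v : G), hgB v⟩
  have hsum : f = ∑ k, Function.extend Subtype.val (F k) 0 := by
    ext g
    rw [Finset.sum_apply]
    by_cases hg : g ∈ V
    · simpa [Subtype.val_injective.extend_apply _ _ (⟨g, hg⟩ : V)] using congrFun hfF ⟨g, hg⟩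
    · simp [hfV g hg, hg]
  rw [hsum]
  refine Submodule.sum_mem _ fun k _ => Submodule.subset_span ?_
  obtain ⟨hcont, hsupp, g, hg⟩ := hF k
  have hbis := (hB g).mono (hV.inter (hB g).1) Set.inter_subset_right
  have hext := compactlySupportedOn_extend hcont hsupp hg
  exact ⟨⟨_, hext.mem_Cc hbis⟩, ⟨_, hbis, hext⟩, rfl⟩

theorem CompactlySupportedOn.star_inv {B : Set G} {f : G → ℂ} (hf : CompactlySupportedOn B f) :
    CompactlySupportedOn B⁻¹ fun g => star (f g⁻¹) := by
  have hinv : Continuous fun g : G => g⁻¹ := IsLocallyCompactEtale.continuous_inv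
  obtain ⟨hc, K, hKB, hK, hKf⟩ := hf
  refine ⟨continuous_star.comp_continuousOn (hc.comp hinv.continuousOn fun _ h => h),
    K⁻¹, Set.preimage_mono hKB, ?_, fun g hg => star_eq_zero.2 (hKf g⁻¹ hg)⟩
  have himage : Inv.inv '' K = K⁻¹ :=
    congrFun (Set.image_eq_preimage_of_inverse inv_inv_of inv_inv_of) K
  exact himage ▸ hK.image hinv

end Cc

section Convolution
variable {G : Type u} [ArrowGroupoid G]

/-- The convolution product `(f₁ * f₂)(g) = ∑_{h ∈ G^{r(g)}} f₁(h) f₂(h⁻¹g)`. -/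
noncomputable def convolution (f₁ f₂ : G → ℂ) (g : G) : ℂ :=
  ∑' h : RangeFiber (rng g), f₁ h.1 * f₂ (h.1⁻¹ * g)

theorem convolution_eq_of_rng {g : G} {z : UnitSpace G} (h : rng g = z) (f₁ f₂ : G → ℂ) :
    convolution f₁ f₂ g = ∑' h : RangeFiber z, f₁ h.1 * f₂ (h.1⁻¹ * g) := by
  subst h
  rfl

theorem convolution_mul {A : Set G} (hA : Set.InjOn (rng : G → UnitSpace G) A) {f₁ : G → ℂ}
    (hf₁ : ∀ g ∉ A, f₁ g = 0) (f₂ : G → ℂ) {a b : G} (ha : a ∈ A) (h : src a = rng b) :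
    convolution f₁ f₂ (a * b) = f₁ a * f₂ b := by
  rw [convolution_eq_of_rng (rng_mul h)]
  let a' : RangeFiber (rng a) := ⟨a, rfl⟩
  refine (tsum_eq_single a' fun c hc => ?_).trans (by rw [inv_mul_cancel_left_of h])
  rw [hf₁ c.1 fun hcA => hc (Subtype.ext (hA hcA ha c.2)), zero_mul]

theorem convolution_eq_zero {A B : Set G} {f₁ f₂ : G → ℂ} (hf₁ : ∀ g ∉ A, f₁ g = 0)
    (hf₂ : ∀ g ∉ B, f₂ g = 0) {g : G} (hg : g ∉ composableMul A B) : convolution f₁ f₂ g = 0 := by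
  rw [convolution, ← tsum_zero (α := ℂ) (β := RangeFiber (rng g))]
  refine tsum_congr fun ⟨h, hh⟩ => mul_eq_zero.2 (or_iff_not_and_not.2 fun ⟨h₁, h₂⟩ => hg ?_)
  refine ⟨(h, h⁻¹ * g), ⟨⟨by_contra (h₁ <| hf₁ _ ·), by_contra (h₂ <| hf₂ _ ·)⟩, ?_⟩,
    mul_inv_cancel_left_of hh⟩
  exact ((rng_mul ((src_inv h).trans hh)).trans (rng_inv h)).symm

theorem CompactlySupportedOn.convolution [TopologicalSpace G] [IsLocallyCompactEtale G]
    {A B : Set G} (hA : IsOpenBisection A) (hB : IsOpenBisection B) {f₁ f₂ : G → ℂ}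
    (hf₁ : CompactlySupportedOn A f₁) (hf₂ : CompactlySupportedOn B f₂) :
    CompactlySupportedOn (composableMul A B) (convolution f₁ f₂) := by
  have hvanish := fun g (hg : g ∉ A) => hf₁.eq_zero hg
  obtain ⟨hc₁, K₁, hK₁A, hK₁, hKf₁⟩ := hf₁
  obtain ⟨hc₂, K₂, hK₂B, hK₂, hKf₂⟩ := hf₂
  refine ⟨?_, composableMul K₁ K₂, Set.image_mono ?_, isCompact_composableMul hK₁ hK₂,
    fun g => convolution_eq_zero hKf₁ hKf₂⟩
  · have hfactors : ContinuousOn (factors B) (composableMul A B) := by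
      refine hB.continuousOn_factors.mono ?_
      rintro _ ⟨⟨a, b⟩, ⟨⟨-, hb⟩, h⟩, rfl⟩
      exact ⟨b, hb, (src_mul h).symm⟩
    have hmem : Set.MapsTo (factors B) (composableMul A B) (A ×ˢ B) := by
      rintro _ ⟨⟨a, b⟩, ⟨⟨ha, hb⟩, h⟩, rfl⟩
      rw [hB.factors_mul h hb]
      exact ⟨ha, hb⟩
    refine (((hc₁.comp continuousOn_fst fun p hp => hp.1).mul
      (hc₂.comp continuousOn_snd fun p hp => hp.2)).comp hfactors hmem).congr ?_
    rintro _ ⟨⟨a, b⟩, ⟨⟨ha, hb⟩, h⟩, rfl⟩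
    simp only [Function.comp_apply, hB.factors_mul h hb]
    exact convolution_mul hA.2.2 hvanish f₂ ha h
  · exact Set.inter_subset_inter_left _ (Set.prod_mono hK₁A hK₂B)

end Convolution

theorem operatorProduct_ext {G : Type u} [ArrowGroupoid G] {a b : OperatorProduct G}
    (h : ∀ y (k g : SourceFiber y), a.1 y (delta k) g = b.1 y (delta k) g) : a = b :=
  Subtype.ext (funext fun y => operator_ext fun k => lp.ext (funext (h y k)))

section RegularRepresentation
variable {G : Type u} [TopologicalSpace G] [ArrowGroupoid G] [IsLocallyCompactEtale G]

theorem rhoCc_apply (y : UnitSpace G) (f : Cc G) (ξ : HilbertFiber y) (g : SourceFiber y) :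
    rhoCc y f ξ g = ∑' k : SourceFiber y, (f : G → ℂ) (g.1 * k.1⁻¹) * ξ k :=
  rhoFun_eq y f ξ g

theorem rhoCc_delta (y : UnitSpace G) (f : Cc G) (k g : SourceFiber y) :
    rhoCc y f (delta k) g = (f : G → ℂ) (g.1 * k.1⁻¹) := by
  rw [rhoCc_apply, tsum_eq_single k] <;> simp +contextual [delta_apply]

/-- The representation `f ↦ (ρ_y(f))_y` of `C_c(G)` as a linear map. -/
noncomputable def rhoFamilyLinear : Cc G →ₗ[ℂ] OperatorProduct G where
  toFun := rhoFamily
  map_add' f₁ f₂ := operatorProduct_ext fun y k g => by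
    change rhoCc y (f₁ + f₂) (delta k) g = rhoCc y f₁ (delta k) g + rhoCc y f₂ (delta k) g
    simp only [rhoCc_delta, Submodule.coe_add, Pi.add_apply]
  map_smul' c f := operatorProduct_ext fun y k g => by
    change rhoCc y (c • f) (delta k) g = c • rhoCc y f (delta k) g
    simp only [rhoCc_delta, Submodule.coe_smul, Pi.smul_apply]

theorem rhoFamily_mul_rhoFamily {f₁ f₂ f : Cc G} (h : (f : G → ℂ) = convolution f₁ f₂) :
    rhoFamily f₁ * rhoFamily f₂ = rhoFamily f := by
  refine operatorProduct_ext fun y k g => ?_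
  change rhoFun y f₁ (rhoCc y f₂ (delta k)) g = rhoCc y f (delta k) g
  rw [rhoCc_delta, h, convolution_eq_of_rng (rng_mul (src_div g k)), rhoFun]
  refine tsum_congr fun l => ?_
  rw [← mul_assoc_of ((src_inv l.1).trans l.2) (src_div g k)]
  exact congrArg _ (rhoCc_delta y f₂ k _)

theorem star_rhoFamily {f₁ f₂ : Cc G} (h : (f₂ : G → ℂ) = fun g => star ((f₁ : G → ℂ) g⁻¹)) :
    star (rhoFamily f₁) = rhoFamily f₂ := by
  refine operatorProduct_ext fun y k g => ?_
  change (rhoCc y f₁).adjoint (delta k) g = rhoCc y f₂ (delta k) g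
  rw [← inner_delta_left, ContinuousLinearMap.adjoint_inner_right, ← inner_conj_symm,
    inner_delta_left, rhoCc_delta, rhoCc_delta, h]
  simp only [mul_inv_rev_of (src_div g k), inv_inv_of]
  rfl

theorem range_rhoFamilyLinear : (rhoFamilyLinear (G := G)).range =
    Submodule.span ℂ (rhoFamilyLinear '' bisectionFunctions G) := by
  rw [LinearMap.range_eq_map, ← span_bisectionFunctions, Submodule.map_span]

theorem mul_mem_range_rhoFamilyLinear {a b : OperatorProduct G}
    (ha : a ∈ (rhoFamilyLinear (G := G)).range) (hb : b ∈ (rhoFamilyLinear (G := G)).range) :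
    a * b ∈ (rhoFamilyLinear (G := G)).range := by
  rw [range_rhoFamilyLinear] at ha hb
  refine LinearMap.BilinMap.apply_apply_mem_of_mem_span _ _ _ (LinearMap.mul ℂ _) ?_ a b ha hb
  rintro _ ⟨f₁, ⟨A, hA, hf₁⟩, rfl⟩ _ ⟨f₂, ⟨B, hB, hf₂⟩, rfl⟩
  exact ⟨⟨_, (hf₁.convolution hA hB hf₂).mem_Cc (hA.mul hB)⟩, (rhoFamily_mul_rhoFamily rfl).symm⟩

theorem star_mem_range_rhoFamilyLinear {a : OperatorProduct G}
    (ha : a ∈ (rhoFamilyLinear (G := G)).range) : star a ∈ (rhoFamilyLinear (G := G)).range := by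
  rw [range_rhoFamilyLinear] at ha
  induction ha using Submodule.span_induction with
  | mem a ha =>
    obtain ⟨f, ⟨B, hB, hf⟩, rfl⟩ := ha
    exact ⟨⟨_, hf.star_inv.mem_Cc hB.inv⟩, (star_rhoFamily rfl).symm⟩
  | zero => simp
  | add a b _ _ ha hb => rw [star_add]; exact add_mem ha hb
  | smul c a _ ha => rw [star_smul]; exact Submodule.smul_mem _ _ ha

/-- The inclusion of `C_c(G)` into its completion `C*_r(G)`. -/
noncomputable def ofCc (f : Cc G) : ReducedCStarAlgebra G :=
  ⟨rhoFamily f, NonUnitalStarSubalgebra.le_topologicalClosure _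
    (NonUnitalStarAlgebra.subset_adjoin ℂ _ ⟨f, rfl⟩)⟩

theorem denseRange_ofCc : DenseRange (ofCc (G := G)) := by
  let S : NonUnitalStarSubalgebra ℂ (OperatorProduct G) :=
    { (rhoFamilyLinear (G := G)).range with
      mul_mem' := mul_mem_range_rhoFamilyLinear
      star_mem' := star_mem_range_rhoFamilyLinear }
  have hS : NonUnitalStarAlgebra.adjoin ℂ (Set.range (rhoFamily (G := G))) ≤ S :=
    NonUnitalStarAlgebra.adjoin_le fun _ ha => ha
  refine fun a => closure_subtype.2 (closure_mono ?_ a.2)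
  exact fun b hb => let ⟨f, hf⟩ := hS hb; ⟨ofCc f, ⟨f, rfl⟩, hf⟩

end RegularRepresentation

theorem exists_compactlySupported_eq_one {X : Type*} [TopologicalSpace X] [T2Space X]
    [LocallyCompactSpace X] {U : Set X} {x : X} (hU : U ∈ 𝓝 x) :
    ∃ φ : C_c(X, ℂ), tsupport φ ⊆ U ∧ φ x = 1 := by
  obtain ⟨φ, hφ, hc, hφU, -⟩ := exists_continuousMap_one_of_isCompact_subset_isOpen
    isCompact_singleton isOpen_interior
    (Set.singleton_subset_iff.2 (mem_interior_iff_mem_nhds.2 hU))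
  refine ⟨⟨⟨fun z => φ z, Complex.continuous_ofReal.comp φ.continuous⟩,
    HasCompactSupport.comp_left (f := φ) hc Complex.ofReal_zero⟩, ?_, ?_⟩
  · exact (closure_mono (Function.support_comp_subset Complex.ofReal_zero φ)).trans
      (hφU.trans interior_subset)
  · exact congrArg Complex.ofReal (hφ rfl)

section BisectionLift
variable {G : Type u} [TopologicalSpace G] [ArrowGroupoid G] [IsLocallyCompactEtale G]
  {B : Set G}

/-- The function `φ ∘ s` on the open bisection `B`, extended by zero, for `φ ∈ C_c(G⁽⁰⁾)` supported
in `s(B)`. -/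
noncomputable def bisectionLift (hB : IsOpenBisection B) (φ : C_c(UnitSpace G, ℂ))
    (hφ : tsupport φ ⊆ src '' B) : Cc G :=
  ⟨B.indicator (φ ∘ src), CompactlySupportedOn.mem_Cc hB
    ⟨(φ.continuous.comp continuous_src).continuousOn.congr (Set.eqOn_indicator),
      sourceSection B '' tsupport φ, by
        rintro _ ⟨y, hy, rfl⟩
        obtain ⟨b, hb, rfl⟩ := hφ hy
        rwa [hB.sourceSection_src hb],
      φ.hasCompactSupport.isCompact.image_of_continuousOn (hB.continuousOn_sourceSection.mono hφ),
      fun g hg => by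
        by_contra h
        have hgB := Set.mem_of_indicator_ne_zero h
        rw [Set.indicator_of_mem hgB] at h
        exact hg ⟨src g, subset_tsupport _ h, hB.sourceSection_src hgB⟩⟩⟩

theorem rhoCc_bisectionLift_apply (hB : IsOpenBisection B) {φ : C_c(UnitSpace G, ℂ)}
    (hφ : tsupport φ ⊆ src '' B) {y : UnitSpace G} (ξ : HilbertFiber y) {k : SourceFiber y}
    (hk : (rng k.1 : G) ∈ B) : rhoCc y (bisectionLift hB φ hφ) ξ k = φ (rng k.1) * ξ k := by
  rw [rhoCc_apply, tsum_eq_single k fun l hl => ?_]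
  · have hmul : k.1 * k.1⁻¹ = (rng k.1 : G) := mul_inv_self k.1
    simp only [bisectionLift, hmul, Set.indicator_of_mem hk, Function.comp_apply, src_coe]
  · refine mul_eq_zero_of_left (Set.indicator_of_notMem (fun hkl => hl ?_) _) _
    have hunit : k.1 * l.1⁻¹ = (rng k.1 : G) :=
      hB.2.2 hkl hk ((rng_mul (src_div k l)).trans (rng_coe _).symm)
    have hrng : rng l.1 = rng k.1 := by
      rw [← src_coe (rng k.1), ← hunit, src_mul (src_div k l), src_inv]
    refine Subtype.ext ?_
    calc l.1 = (rng l.1 : G) * l.1 := (rng_mul_self l.1).symm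
      _ = k.1 * l.1⁻¹ * l.1 := by rw [hrng, hunit]
      _ = k.1 := inv_mul_cancel_right_of (k.2.trans l.2.symm)

end BisectionLift

section VectorStates
variable {G : Type u} [ArrowGroupoid G]

/-- The unit `y` as an element of the fibre `G_y`. -/
def unitArrow (y : UnitSpace G) : SourceFiber y := ⟨y, src_coe y⟩

variable [TopologicalSpace G] [IsLocallyCompactEtale G]

theorem rhoCc_bisectionLift_delta {B : Set G} (hB : IsOpenBisection B) {φ : C_c(UnitSpace G, ℂ)}
    (hφ : tsupport φ ⊆ src '' B) {y : UnitSpace G} (hφy : φ y = 1) {k : SourceFiber y}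
    (hk : k.1 ∈ B) : rhoCc y (bisectionLift hB φ hφ) (delta (unitArrow y)) = delta k := by
  classical
  ext g
  rw [rhoCc_delta, delta_apply, unitArrow, mul_unit_inv g.2]
  split_ifs with hgk
  · simp [bisectionLift, hgk, hk, k.2, hφy]
  · exact Set.indicator_of_notMem
      (fun hg => hgk (Subtype.ext (hB.2.1 hg hk (g.2.trans k.2.symm)))) _

/-- The coefficient `⟨ρ_y(a) δ_y, δ_y⟩` as a function of the unit `y`. -/
noncomputable def unitCoeff (a : ReducedCStarAlgebra G) (y : UnitSpace G) : ℂ :=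
  rho y a (delta (unitArrow y)) (unitArrow y)

theorem unitCoeff_ofCc (f : Cc G) (y : UnitSpace G) : unitCoeff (ofCc f) y = (f : G → ℂ) y :=
  (rhoCc_delta y f _ _).trans (congrArg f.1 (mul_unit_inv (src_coe y)))

theorem dist_unitCoeff_le (a b : ReducedCStarAlgebra G) (y : UnitSpace G) :
    dist (unitCoeff a y) (unitCoeff b y) ≤ dist a b := by
  have hsub : unitCoeff a y - unitCoeff b y = unitCoeff (a - b) y := by
    simp only [unitCoeff, map_sub]
    rfl
  rw [dist_eq_norm, dist_eq_norm, hsub]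
  calc ‖unitCoeff (a - b) y‖ ≤ ‖rho y (a - b) (delta (unitArrow y))‖ :=
        lp.norm_apply_le_norm two_ne_zero _ _
    _ ≤ ‖rho y (a - b)‖ := ContinuousLinearMap.unit_le_opNorm _ _ (norm_delta _).le
    _ ≤ ‖a - b‖ := NonUnitalStarAlgHom.norm_apply_le _ _

theorem unitCoeff_star_mul_self (a : ReducedCStarAlgebra G) (y : UnitSpace G) :
    unitCoeff (star a * a) y = (‖rho y a (delta (unitArrow y))‖ : ℂ) ^ 2 := by
  have h : rho y (star a * a) = (rho y a).adjoint ∘L rho y a := by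
    rw [map_mul, map_star]
    rfl
  rw [unitCoeff, ← inner_delta_left, h, ContinuousLinearMap.comp_apply,
    ContinuousLinearMap.adjoint_inner_right]
  exact inner_self_eq_norm_sq_to_K _

theorem tendsto_unitCoeff {l : Filter (UnitSpace G)} {x : UnitSpace G}
    (h : ∀ f : Cc G, Tendsto (fun y : UnitSpace G => (f : G → ℂ) y) l (𝓝 ((f : G → ℂ) x)))
    (a : ReducedCStarAlgebra G) : Tendsto (unitCoeff a) l (𝓝 (unitCoeff a x)) := by
  have hne : (comap ofCc (𝓝 a)).NeBot := comap_neBot fun s hs =>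
    let ⟨_, hb, f, hf⟩ := mem_closure_iff_nhds.1 (denseRange_ofCc a) s hs
    ⟨f, hf ▸ hb⟩
  have huniform : TendstoUniformly (fun f : Cc G => unitCoeff (ofCc f)) (unitCoeff a)
      (comap ofCc (𝓝 a)) := Metric.tendstoUniformly_iff.2 fun ε hε =>
    (tendsto_comap.eventually (Metric.ball_mem_nhds a hε)).mono fun f hf y =>
      (dist_unitCoeff_le _ _ _).trans_lt (by rwa [dist_comm])
  refine huniform.tendsto_of_eventually_tendsto (.of_forall fun f => ?_) (huniform.tendsto_at x)
  simpa only [funext (unitCoeff_ofCc f)] using h f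

/-- `δ_x` is cyclic for `ρ_x`, and its vector state is the limit of those of the `δ_y`. -/
theorem weaklyContained_rho_of_tendsto {Y : Set (UnitSpace G)} {x : UnitSpace G}
    {l : Filter (UnitSpace G)} [l.NeBot] (hY : Y ∈ l)
    (h : ∀ f : Cc G, Tendsto (fun y : UnitSpace G => (f : G → ℂ) y) l (𝓝 ((f : G → ℂ) x))) :
    WeaklyContained (rho x) (directSum fun y : Y => rho (y : UnitSpace G)) := by
  intro a ha
  rw [directSum_eq_zero_iff] at ha
  refine operator_ext fun k => ?_
  obtain ⟨B, hB, hkB⟩ := exists_isOpenBisection k.1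
  obtain ⟨φ, hφ, hφx⟩ := exists_compactlySupported_eq_one (x := x)
    ((isOpenMap_src B hB.1).mem_nhds ⟨k.1, hkB, k.2⟩)
  let b := a * ofCc (bisectionLift hB φ hφ)
  have hb (y : UnitSpace G) (ξ : HilbertFiber y) :
      rho y b ξ = rho y a (rhoCc y (bisectionLift hB φ hφ) ξ) := rfl
  have hzero : (fun _ => 0) =ᶠ[l] unitCoeff (star b * b) := by
    filter_upwards [hY] with y hy
    rw [unitCoeff_star_mul_self, hb, ha ⟨y, hy⟩]
    simp
  have hlim := tendsto_nhds_unique (tendsto_unitCoeff h _) (tendsto_const_nhds.congr' hzero)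
  rw [unitCoeff_star_mul_self, hb, rhoCc_bisectionLift_delta hB hφ hφx hkB] at hlim
  simpa using hlim

end VectorStates

section Approach
variable {G : Type u} [TopologicalSpace G] [ArrowGroupoid G]

/-- The open bisections that contain a nontrivial element of the isotropy group of `x`. -/
def nontrivialBisections (x : UnitSpace G) : Set (Set G) :=
  {B | IsOpenBisection B ∧ ∃ g : Isotropy x, g ≠ 1 ∧ (g : G) ∈ B}

/-- The filter of the points of `Y` that are close to `x` while staying, as arrows, outside any
finitely many open bisections around nontrivial isotropy elements of `x`; improper filters are
allowed. -/
def approachFilter (Y : Set (UnitSpace G)) (x : UnitSpace G) : Filter (UnitSpace G) :=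
  𝓝[Y] x ⊓ ⨅ B ∈ nontrivialBisections x, 𝓟 {y | (y : G) ∉ B}

variable {Y : Set (UnitSpace G)} {x : UnitSpace G}

theorem approachFilter_le_nhds : approachFilter Y x ≤ 𝓝 x :=
  inf_le_left.trans nhdsWithin_le_nhds

theorem mem_approachFilter_self : Y ∈ approachFilter Y x :=
  mem_inf_of_left self_mem_nhdsWithin

theorem eventually_notMem_of_mem_nontrivialBisections {B : Set G}
    (hB : B ∈ nontrivialBisections x) : ∀ᶠ y in approachFilter Y x, ((y : UnitSpace G) : G) ∉ B :=
  mem_inf_of_right (mem_iInf_of_mem B (mem_iInf_of_mem hB (mem_principal_self _)))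

theorem coveredNear_iff (hx : x ∈ closure Y) : CoveredNear Y x ↔
    ∃ T ⊆ nontrivialBisections x, T.Finite ∧ ∀ᶠ y in 𝓝[Y] x, ((y : UnitSpace G) : G) ∈ ⋃₀ T := by
  constructor
  · rintro ⟨n, -, g, B, U, hB, hU, hYU⟩
    refine ⟨Set.range B, Set.range_subset_iff.2 fun k => ⟨(hB k).2.1, g k, (hB k).1, (hB k).2.2⟩,
      Set.finite_range B, ?_⟩
    filter_upwards [inter_mem_nhdsWithin Y hU] with y hy using hYU y hy
  · rintro ⟨T, hT, hfin, hYT⟩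
    have : (𝓝[Y] x).NeBot := mem_closure_iff_nhdsWithin_neBot.1 hx
    obtain ⟨y, B, hBT, -⟩ := hYT.exists
    obtain ⟨U, hU, hYU⟩ := mem_nhdsWithin_iff_exists_mem_nhds_inter.1 hYT
    obtain ⟨n, D, -, rfl⟩ := hfin.fin_param
    choose hD g hg hgD using fun k => hT (Set.mem_range_self k)
    obtain ⟨k, -⟩ := hBT
    exact ⟨n, k.pos, g, D, U, fun k => ⟨hg k, hD k, hgD k⟩, hU,
      fun y hy => hYU hy.symm⟩

theorem neBot_approachFilter_iff (hx : x ∈ closure Y) :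
    (approachFilter Y x).NeBot ↔ ¬ CoveredNear Y x := by
  rw [coveredNear_iff hx, neBot_iff, ne_eq, not_iff_not, approachFilter, ← disjoint_iff,
    (basis_sets _).disjoint_iff_right]
  constructor
  · rintro ⟨V, hV, hVY⟩
    obtain ⟨T, hfin, hT, hTV⟩ := mem_biInf_principal.1 hV
    refine ⟨T, hT, hfin, mem_of_superset hVY fun y hy => by_contra fun h => hy (hTV ?_)⟩
    exact Set.mem_iInter₂.2 fun B hB hyB => h ⟨B, hB, hyB⟩
  · rintro ⟨T, hT, hfin, hYT⟩
    exact ⟨_, mem_biInf_principal.2 ⟨T, hfin, hT, subset_rfl⟩,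
      hYT.mono fun y ⟨B, hB, hyB⟩ hy => Set.mem_iInter₂.1 hy B hB hyB⟩

variable [IsLocallyCompactEtale G]

theorem tendsto_coe_of_mem_bisection {l : Filter (UnitSpace G)} (hl : l ≤ 𝓝 x) {B : Set G}
    (hB : IsOpenBisection B) {g : G} (hg : g ∈ B) (hgx : src g = x)
    (h : ∀ᶠ y in l, ((y : UnitSpace G) : G) ∈ B) :
    Tendsto ((↑) : UnitSpace G → G) l (𝓝 g) := by
  have hx : src '' B ∈ 𝓝 x := (isOpenMap_src B hB.1).mem_nhds ⟨g, hg, hgx⟩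
  have hcont := (hB.continuousOn_sourceSection.continuousAt hx).tendsto
  rw [← hgx, hB.sourceSection_src hg, hgx] at hcont
  exact (hcont.mono_left hl).congr' (h.mono fun y hy => by
    simpa only [src_coe] using hB.sourceSection_src hy)

theorem eq_of_mapClusterPt_approachFilter {g : G}
    (hg : MapClusterPt g (approachFilter Y x) ((↑) : UnitSpace G → G)) : g = x := by
  have eq_of_retraction {p : G → UnitSpace G} (hp : Continuous p)
      (hpc : ∀ y : UnitSpace G, p y = y) : p g = x := by
    have hcl := hg.continuousAt_comp hp.continuousAt
    rw [show p ∘ (↑) = id from funext hpc] at hcl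
    exact eq_of_nhds_neBot ((mapClusterPt_id_iff.1 hcl).mono approachFilter_le_nhds)
  have hsrc := eq_of_retraction continuous_src src_coe
  have hrng := eq_of_retraction continuous_rng rng_coe
  by_contra hne
  obtain ⟨B, hB, hgB⟩ := exists_isOpenBisection g
  let γ : Isotropy x := ⟨g, hsrc, hrng⟩
  have hBx : B ∈ nontrivialBisections x := ⟨hB, γ, fun h => hne (congrArg Subtype.val h), hgB⟩
  exact mapClusterPt_iff_frequently.1 hg B (hB.1.mem_nhds hgB)
    (eventually_notMem_of_mem_nontrivialBisections hBx)

theorem tendsto_Cc_of_unique_clusterPt {l : Filter (UnitSpace G)} (hl : l ≤ 𝓝 x)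
    (hacc : ∀ g : G, MapClusterPt g l ((↑) : UnitSpace G → G) → g = x) (f : Cc G) :
    Tendsto (fun y : UnitSpace G => (f : G → ℂ) y) l (𝓝 ((f : G → ℂ) x)) := by
  have hf : f ∈ Submodule.span ℂ (bisectionFunctions G) := by
    rw [span_bisectionFunctions]
    trivial
  induction hf using Submodule.span_induction with
  | zero => exact tendsto_const_nhds
  | add f₁ f₂ _ _ h₁ h₂ => exact h₁.add h₂
  | smul c f _ h => exact h.const_smul c
  | mem f hf =>
    obtain ⟨B, hB, hfB⟩ := hf
    by_cases hxB : (x : G) ∈ B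
    · have hcont := hfB.1.continuousAt (hB.1.mem_nhds hxB)
      exact (hcont.comp continuous_subtype_val.continuousAt).tendsto.mono_left hl
    · obtain ⟨-, K, hKB, hK, hfK⟩ := id hfB
      have hnotMem : ∀ᶠ y in l, ((y : UnitSpace G) : G) ∉ K := by
        by_contra h
        obtain ⟨g, hgK, hg⟩ := hK.exists_mapClusterPt_of_frequently h
        exact hxB (hacc g hg ▸ hKB hgK)
      rw [hfB.eq_zero hxB]
      exact tendsto_const_nhds.congr' (hnotMem.mono fun y hy => (hfK y hy).symm)

theorem weaklyContained_of_neBot_approachFilter [(approachFilter Y x).NeBot] :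
    WeaklyContained (rho x) (directSum fun y : Y => rho (y : UnitSpace G)) :=
  weaklyContained_rho_of_tendsto mem_approachFilter_self
    (tendsto_Cc_of_unique_clusterPt approachFilter_le_nhds fun _ =>
      eq_of_mapClusterPt_approachFilter)

theorem existsNetUniqueAcc_iff_neBot_approachFilter :
    ExistsNetUniqueAcc Y x ↔ (approachFilter Y x).NeBot := by
  constructor
  · rintro ⟨ι, _, _, _, y, hyY, hacc⟩
    obtain ⟨u, hu, hyx⟩ := mapClusterPt_iff_ultrafilter.1 ((hacc 1).2 rfl)
    have hle : Tendsto y u (𝓝 x) := by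
      simpa only [Function.comp_def, src_coe] using (continuous_src.tendsto (x : G)).comp hyx
    refine (u.map y).neBot.mono (le_inf (le_inf hle ?_) (le_iInf₂ fun B ⟨hB, g, hg, hgB⟩ => ?_))
    · exact tendsto_principal.2 (.of_forall hyY)
    · refine tendsto_principal.2 (Ultrafilter.eventually_not.2 fun hyB => hg ((hacc g).1 ?_))
      exact mapClusterPt_iff_ultrafilter.2
        ⟨u, hu, tendsto_coe_of_mem_bisection hle hB hgB g.2.1 (eventually_map.2 hyB)⟩
  · intro hne
    have := comap_coe_neBot_of_le_principal
      (le_principal_iff.2 (mem_approachFilter_self (Y := Y) (x := x)))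
    obtain ⟨ι, hpre, hdir, hι, y, hy⟩ :=
      exists_net_tendsto (comap ((↑) : Y → UnitSpace G) (approachFilter Y x))
    have hlim := tendsto_comap.comp hy
    refine ⟨ι, hpre, hdir, hι, fun i => y i, fun i => (y i).2, fun g => ⟨fun hg => ?_, ?_⟩⟩
    · exact Subtype.ext (eq_of_mapClusterPt_approachFilter (hg.of_comp hlim))
    · rintro rfl
      exact ((continuous_subtype_val.tendsto x).comp
        (hlim.mono_right approachFilter_le_nhds)).mapClusterPt

end Approach

section Average
variable {G : Type u} [TopologicalSpace G] [ArrowGroupoid G] [IsLocallyCompactEtale G]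
  {ι : Type*} [Fintype ι] {B : ι → Set G}

/-- The average of the lifts of `φ ∈ C_c(G⁽⁰⁾)` to finitely many open bisections. -/
noncomputable def bisectionAverage (hB : ∀ i, IsOpenBisection (B i)) (φ : C_c(UnitSpace G, ℂ))
    (hφ : ∀ i, tsupport φ ⊆ src '' B i) : ReducedCStarAlgebra G :=
  (Fintype.card ι : ℂ)⁻¹ • ∑ i, ofCc (bisectionLift (hB i) φ (hφ i))

theorem rho_bisectionAverage (hB : ∀ i, IsOpenBisection (B i)) {φ : C_c(UnitSpace G, ℂ)}
    (hφ : ∀ i, tsupport φ ⊆ src '' B i) {y : UnitSpace G} (ξ : HilbertFiber y) :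
    rho y (bisectionAverage hB φ hφ) ξ =
      (Fintype.card ι : ℂ)⁻¹ • ∑ i, rhoCc y (bisectionLift (hB i) φ (hφ i)) ξ := by
  rw [bisectionAverage, map_smul, map_sum, smul_apply, sum_apply]
  rfl

theorem rho_bisectionAverage_apply [Nonempty ι] (hB : ∀ i, IsOpenBisection (B i))
    {φ : C_c(UnitSpace G, ℂ)} (hφ : ∀ i, tsupport φ ⊆ src '' B i) {y : UnitSpace G}
    (ξ : HilbertFiber y) {k : SourceFiber y} (hk : ∀ i, (rng k.1 : G) ∈ B i) :
    rho y (bisectionAverage hB φ hφ) ξ k = φ (rng k.1) * ξ k := by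
  rw [rho_bisectionAverage, lp.coeFn_smul, Pi.smul_apply, lp.coeFn_sum, Finset.sum_apply,
    Finset.sum_congr rfl fun i _ => rhoCc_bisectionLift_apply (hB i) (hφ i) ξ (hk i),
    Finset.sum_const, Finset.card_univ, nsmul_eq_mul, smul_eq_mul,
    inv_mul_cancel_left₀ (Nat.cast_ne_zero.2 Fintype.card_ne_zero)]

theorem norm_rho_bisectionAverage_delta_sq (hB : ∀ i, IsOpenBisection (B i))
    {φ : C_c(UnitSpace G, ℂ)} (hφ : ∀ i, tsupport φ ⊆ src '' B i) {x : UnitSpace G}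
    (hφx : φ x = 1) (k : ι ↪ SourceFiber x) (hk : ∀ i, (k i).1 ∈ B i) :
    ‖rho x (bisectionAverage hB φ hφ) (delta (unitArrow x))‖ ^ 2 = 1 / Fintype.card ι := by
  have hsum : ∑ i, rhoCc x (bisectionLift (hB i) φ (hφ i)) (delta (unitArrow x)) =
      ∑ l ∈ Finset.univ.map k, delta l := by
    rw [Finset.sum_map]
    exact Finset.sum_congr rfl fun i _ => rhoCc_bisectionLift_delta (hB i) (hφ i) hφx (hk i)
  rw [rho_bisectionAverage, hsum, norm_smul, mul_pow, norm_sum_delta_sq, Finset.card_map,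
    Finset.card_univ, norm_inv, Complex.norm_natCast, sq, one_div]
  simpa only [inv_inv] using mul_self_mul_inv (Fintype.card ι : ℝ)⁻¹

theorem norm_sq_rho_bisectionLift_le_sum {α : Type*} [Fintype α] {ι : α → Type*}
    [∀ i, Fintype (ι i)] [∀ i, Nonempty (ι i)] {B : ∀ i, ι i → Set G}
    (hB : ∀ i j, IsOpenBisection (B i j)) {φ : C_c(UnitSpace G, ℂ)}
    (hφ : ∀ i j, tsupport φ ⊆ src '' B i j)
    (hφU : tsupport φ ⊆ src '' Set.range ((↑) : UnitSpace G → G)) {y : UnitSpace G}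
    (hy : ∀ k : SourceFiber y, rng k.1 ∈ tsupport φ → ∃ i, ∀ j, (rng k.1 : G) ∈ B i j)
    (ξ : HilbertFiber y) :
    ‖rho y (ofCc (bisectionLift isOpenBisection_range_coe φ hφU)) ξ‖ ^ 2 ≤
      ∑ i, ‖rho y (bisectionAverage (hB i) φ (hφ i)) ξ‖ ^ 2 := by
  refine norm_sq_le_sum_norm_sq _ _ _ fun k => ?_
  have hunit : rho y (ofCc (bisectionLift isOpenBisection_range_coe φ hφU)) ξ k =
      φ (rng k.1) * ξ k := rhoCc_bisectionLift_apply _ hφU ξ ⟨_, rfl⟩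
  by_cases hk : rng k.1 ∈ tsupport φ
  · obtain ⟨i, hi⟩ := hy k hk
    rw [hunit, ← rho_bisectionAverage_apply (hB i) (hφ i) ξ hi]
    exact Finset.single_le_sum (f := fun i => ‖rho y (bisectionAverage (hB i) φ (hφ i)) ξ k‖ ^ 2)
      (fun i _ => sq_nonneg _) (Finset.mem_univ i)
  · rw [hunit, image_eq_zero_of_notMem_tsupport hk, zero_mul, norm_zero, zero_pow two_ne_zero]
    exact Finset.sum_nonneg fun i _ => sq_nonneg _

end Average

section Covered
variable {G : Type u} [TopologicalSpace G] [ArrowGroupoid G] [IsLocallyCompactEtale G]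
  {Y : Set (UnitSpace G)} {x : UnitSpace G}

/-- Compare `δ_x` with the averages over `S i`: at points `y ∈ Y` near `x` they dominate the
corresponding function on the units, while their squared norms at `δ_x` are `1 / |S i|`. -/
theorem WeaklyContained.one_le_sum_one_div_card
    (h : WeaklyContained (rho x) (directSum fun y : Y => rho (y : UnitSpace G)))
    (hY : GroupoidInvariant Y) {α : Type*} [Fintype α] (S : α → Finset (Isotropy x))
    (hS : ∀ i, (S i).Nonempty) {D : Isotropy x → Set G} (hD : ∀ g, IsOpenBisection (D g))
    (hgD : ∀ g : Isotropy x, (g : G) ∈ D g)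
    (hYD : ∀ᶠ y in 𝓝[Y] x, ∃ i, ∀ g ∈ S i, ((y : UnitSpace G) : G) ∈ D g) :
    1 ≤ ∑ i, (1 : ℝ) / (S i).card := by
  have hsrc : ∀ᶠ y in 𝓝 x, ∀ i, ∀ g ∈ S i, y ∈ src '' D g :=
    eventually_all.2 fun i => (Finset.eventually_all _).2 fun g _ =>
      (isOpenMap_src _ (hD g).1).mem_nhds ⟨g, hgD g, g.2.1⟩
  obtain ⟨φ, hφ, hφx⟩ :=
    exists_compactlySupported_eq_one (hsrc.and (eventually_nhdsWithin_iff.1 hYD))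
  have hφS (i) (g : S i) : tsupport φ ⊆ src '' D g := fun y hy => (hφ hy).1 i g g.2
  have hφU : tsupport φ ⊆ src '' Set.range ((↑) : UnitSpace G → G) :=
    fun y _ => ⟨y, ⟨y, rfl⟩, src_coe y⟩
  have _ (i) : Nonempty (S i) := (hS i).to_subtype
  have hdom (y : Y) (ξ : HilbertFiber (y : UnitSpace G)) :=
    norm_sq_rho_bisectionLift_le_sum (fun i (g : S i) => hD g) hφS hφU
      (fun k hk => by
        obtain ⟨i, hi⟩ := (hφ hk).2 ((hY k.1).1 (k.2.symm ▸ y.2))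
        exact ⟨i, fun g => hi g g.2⟩) ξ
  have hx := h.norm_sq_le_sum Finset.univ _ _ hdom (delta (unitArrow x))
  let e : Isotropy x ↪ SourceFiber x := ⟨fun g => ⟨g, g.2.1⟩, fun g g' he =>
    Subtype.ext (congrArg (fun k : SourceFiber x => k.1) he)⟩
  have havg (i) := norm_rho_bisectionAverage_delta_sq (fun g : S i => hD g) (hφS i) hφx
    ((Function.Embedding.subtype _).trans e) fun g => hgD g
  have hone : rho x (ofCc (bisectionLift isOpenBisection_range_coe φ hφU)) (delta (unitArrow x)) =
      delta (unitArrow x) := rhoCc_bisectionLift_delta _ hφU hφx ⟨x, rfl⟩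
  simpa only [havg, hone, norm_delta, one_pow, Fintype.card_coe] using hx

theorem tendsto_coe_of_mem_zpowers {l : Filter (UnitSpace G)} (hl : l ≤ 𝓝 x) {g h : Isotropy x}
    (hg : Tendsto ((↑) : UnitSpace G → G) l (𝓝 (g : G))) (hh : h ∈ Subgroup.zpowers g) :
    Tendsto ((↑) : UnitSpace G → G) l (𝓝 (h : G)) := by
  let limits : Subgroup (Isotropy x) :=
    { carrier := {h | Tendsto ((↑) : UnitSpace G → G) l (𝓝 (h : G))}
      one_mem' := (continuous_subtype_val.tendsto x).mono_left hl
      mul_mem' := fun {a b} ha hb =>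
        (tendsto_mul ha hb (.of_forall fun y => (src_coe y).trans (rng_coe y).symm)
          (a.2.1.trans b.2.2.symm)).congr UnitSpace.mul_self
      inv_mem' := fun {a} ha =>
        (((IsLocallyCompactEtale.continuous_inv (G := G)).tendsto (a : G)).comp ha).congr
          UnitSpace.inv_coe }
  exact (Subgroup.zpowers_le (H := limits)).2 hg hh

theorem CoveredNear.exists_nhdsWithin_le_iSup (h : CoveredNear Y x) :
    ∃ F : Finset (Subgroup (Isotropy x)), (∀ C ∈ F, IsCyclic C ∧ C ≠ ⊥) ∧
      𝓝[Y] x ≤ ⨆ C ∈ F, ⨅ h ∈ C, comap ((↑) : UnitSpace G → G) (𝓝 (h : G)) := by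
  classical
  obtain ⟨n, -, g, B, U, hB, hU, hYU⟩ := h
  refine ⟨Finset.univ.image fun j => Subgroup.zpowers (g j), ?_, ?_⟩
  · simp only [Finset.forall_mem_image]
    exact fun j _ => ⟨inferInstance, fun hj => (hB j).1 (Subgroup.zpowers_eq_bot.1 hj)⟩
  · have hcover : 𝓝[Y] x ≤ ⨆ j, 𝓝 x ⊓ 𝓟 {y | (y : G) ∈ B j} := by
      intro s hs
      have hBs : ∀ᶠ y in 𝓝 x, ∀ j, ((y : UnitSpace G) : G) ∈ B j → y ∈ s :=
        eventually_all.2 fun j => mem_inf_principal.1 (mem_iSup.1 hs j)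
      filter_upwards [inter_mem_nhdsWithin Y hU, nhdsWithin_le_nhds hBs] with y hy hys
      obtain ⟨j, hj⟩ := Set.mem_iUnion.1 (hYU y hy)
      exact hys j hj
    refine hcover.trans (iSup_le fun j => le_iSup₂_of_le (Subgroup.zpowers (g j))
      (Finset.mem_image_of_mem _ (Finset.mem_univ j)) (le_iInf₂ fun h hh => ?_))
    exact (tendsto_coe_of_mem_zpowers inf_le_left (tendsto_coe_of_mem_bisection inf_le_left
      (hB j).2.1 (hB j).2.2 (g j).2.1 (mem_inf_of_right (mem_principal_self _))) hh).le_comap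

theorem not_weaklyContained_of_coveredNear (hY : GroupoidInvariant Y)
    (hfew : FewCyclicSubgroups (Isotropy x)) (h : CoveredNear Y x) :
    ¬ WeaklyContained (rho x) (directSum fun y : Y => rho (y : UnitSpace G)) := by
  obtain ⟨F, hF, hle⟩ := h.exists_nhdsWithin_le_iSup
  have hsum : ∑ C : F, (1 : ℝ) / Nat.card (C.1 : Set (Isotropy x)) < 1 :=
    (Finset.sum_coe_sort F fun C => (1 : ℝ) / Nat.card C).trans_lt (hfew F hF)
  obtain ⟨S, hS, hS1⟩ := exists_finsets_sum_one_div_card_lt Finset.univ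
    (fun C : F => ⟨1, C.1.one_mem⟩) hsum
  choose D hD hgD using fun g : Isotropy x => exists_isOpenBisection (g : G)
  refine fun hw => hS1.not_ge (hw.one_le_sum_one_div_card hY S (fun C => (hS C).1) hD hgD ?_)
  have hnear (C : F) : ∀ᶠ y in ⨅ h ∈ C.1, comap ((↑) : UnitSpace G → G) (𝓝 (h : G)),
      ∀ g ∈ S C, ((y : UnitSpace G) : G) ∈ D g :=
    (Finset.eventually_all _).2 fun g hg => mem_iInf_of_mem g <| mem_iInf_of_mem ((hS C).2 hg) <|
      preimage_mem_comap ((hD g).1.mem_nhds (hgD g))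
  refine hle (mem_iSup.2 fun C => mem_iSup.2 fun hC => ?_)
  exact (hnear ⟨C, hC⟩).mono fun y hy => ⟨⟨C, hC⟩, hy⟩

end Covered

end EtaleGroupoid

theorem corollary1p9 {G : Type u} [TopologicalSpace G] [ArrowGroupoid G] [IsLocallyCompactEtale G]
    (Y : Set (UnitSpace G)) (hY : GroupoidInvariant Y)
    (x : UnitSpace G) (hx : x ∈ closure Y) (hxY : x ∉ Y)
    (hfew : FewCyclicSubgroups (Isotropy x)) :
    (WeaklyContained (rho x) (directSum fun y : Y => rho (y : UnitSpace G)) ↔ ¬ CoveredNear Y x) ∧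
      (¬ CoveredNear Y x ↔ ExistsNetUniqueAcc Y x) := by
  exact ⟨⟨fun hweak hcov => not_weaklyContained_of_coveredNear hY hfew hcov hweak, fun hcov =>
      have := (neBot_approachFilter_iff hx).2 hcov
      weaklyContained_of_neBot_approachFilter⟩,
    (neBot_approachFilter_iff hx).symm.trans existsNetUniqueAcc_iff_neBot_approachFilter.symm⟩
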